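/- Let $S$ be a scheme and $G$ a group scheme over $S$ that is affine over $S$. A $G$-equivariant vector bundle on $S$ is a locally free $\mathcal{O}_S$-module $\mathcal{E}$ of finite rank with a homomorphism $G \to \operatorname{Aut}(\mathcal{E})$ of group functors on $S$-schemes, that is, an action of $G(T)$ on $\mathcal{E}_T$ by $\mathcal{O}_T$-linear automorphisms for every $S$-scheme $T$, compatible with base change; it is faithful if $G \to \operatorname{Aut}(\mathcal{E})$ is a monomorphism. The group scheme $G$ is trigonalizable if it admits a faithful $G$-equivariant vector bundle $\mathcal{E}$ with a filtration $0 = \mathcal{E}^n \subset \mathcal{E}^{n-1} \subset \cdots \subset \mathcal{E}^0 = \mathcal{E}$ by $G$-stable submodules such that each quotient $\mathcal{E}^i/\mathcal{E}^{i+1}$ is a line bundle. It is locally trigonalizable if there is a finite locally free surjection $S' \to S$ such that $G \times_S S'$ is trigonalizable over $S'$. Let $k$ be a field with algebraic closure $\bar{k}$, and let $G$ be an affine group scheme of finite type over $k$. Suppose that either (a) $G$ is commutative, or (b) $G$ is smooth, connected and solvable, where solvable means that there is a finite chain $G = G_0 \supset G_1 \supset \cdots \supset G_t = 1$ of closed subgroup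 schemes with each $G_{i+1}$ normal in $G_i$ and $G_i/G_{i+1}$ commutative. Then $G_{\bar{k}}$ is a trigonalizable group scheme over $\bar{k}$, and $G$ is a locally trigonalizable group scheme over $k$. -/

import Mathlib

open CategoryTheory CategoryTheory.Limits MonoidalCategory CartesianMonoidalCategory AlgebraicGeometry
open scoped CategoryTheory.MonObj CategoryTheory.Obj

universe u

noncomputable section

namespace TrigGroupScheme

/-! ### Vector bundles -/

/-- The `𝒪_S`-module `M` is locally free of rank `r`: every point of `S` has an open neighbourhood
on which `M` is isomorphic to `𝒪^r`. -/
def IsLocallyFreeOfRank {S : Scheme.{u}} (M : S.Modules) (r : ℕ) : Prop :=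
  ∀ x : S, ∃ U : S.Opens, x ∈ U ∧
    Nonempty (M.restrict U.ι ≅
      (SheafOfModules.free (ULift.{u} (Fin r)) : (U : Scheme.{u}).Modules))

/-- A line bundle: locally free of rank one. -/
def IsLineBundle {S : Scheme.{u}} (M : S.Modules) : Prop :=
  IsLocallyFreeOfRank M 1

/-- A vector bundle: locally free of finite (locally constant) rank. -/
def IsVectorBundle {S : Scheme.{u}} (M : S.Modules) : Prop :=
  ∀ x : S, ∃ (U : S.Opens) (r : ℕ), x ∈ U ∧
    Nonempty (M.restrict U.ι ≅
      (SheafOfModules.free (ULift.{u} (Fin r)) : (U : Scheme.{u}).Modules))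

/-! ### Equivariant modules -/

/-- The pullback `E_T` of an `𝒪_S`-module `E` to an `S`-scheme `T`. -/
abbrev pull {S : Scheme.{u}} (E : S.Modules) (T : Over S) : T.left.Modules :=
  (Scheme.Modules.pullback T.hom).obj E

/-- The map `E_T ⟶ F_T` induced by a map `E ⟶ F` of `𝒪_S`-modules. -/
abbrev pullMap {S : Scheme.{u}} {E F : S.Modules} (φ : E ⟶ F) (T : Over S) :
    pull E T ⟶ pull F T :=
  (Scheme.Modules.pullback T.hom).map φ

/-- The canonical isomorphism `h^* (E_T) ≅ E_{T'}` for a morphism `h : T' ⟶ T` of `S`-schemes. -/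
def pullIso {S : Scheme.{u}} (E : S.Modules) {T' T : Over S} (h : T' ⟶ T) :
    (Scheme.Modules.pullback h.left).obj (pull E T) ≅ pull E T' :=
  (Scheme.Modules.pullbackComp h.left T.hom).app E ≪≫
    (Scheme.Modules.pullbackCongr (Over.w h)).app E

/-- A `G`-equivariant structure on an `𝒪_S`-module `E`, i.e. a homomorphism `G ⟶ Aut(E)` of group
functors on `S`-schemes: for each `S`-scheme `T` an action of the group `G(T)` on `E_T` by
`𝒪_T`-linear automorphisms, compatible with base change `T' ⟶ T`.
(The product in `Aut` is composition: `(f * g) = f ∘ g`, so that these are left actions.) -/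
structure EquivariantStructure {S : Scheme.{u}} (G : Over S) [GrpObj G] (E : S.Modules) where
  /-- the action of `T`-valued points -/
  act (T : Over S) : (T ⟶ G) →* Aut (pull E T)
  /-- compatibility with base change: `h^* (act g) = act (g ∘ h)` -/
  act_comp {T' T : Over S} (h : T' ⟶ T) (g : T ⟶ G) :
    (Scheme.Modules.pullback h.left).map (act T g).hom ≫ (pullIso E h).hom =
      (pullIso E h).hom ≫ (act T' (h ≫ g)).hom

/-- The equivariant structure is faithful: `G ⟶ Aut(E)` is a monomorphism. -/
def EquivariantStructure.IsFaithful {S : Scheme.{u}} {G : Over S} [GrpObj G] {E : S.Modules}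
    (ρ : EquivariantStructure G E) : Prop :=
  ∀ T : Over S, Function.Injective (ρ.act T)

/-- The submodule `j : F ⟶ E` is `G`-stable: for every `S`-scheme `T`, each `g ∈ G(T)` maps (the
image of) `F_T` in `E_T` into itself. -/
def EquivariantStructure.IsStable {S : Scheme.{u}} {G : Over S} [GrpObj G] {E : S.Modules}
    (ρ : EquivariantStructure G E) {F : S.Modules} (j : F ⟶ E) : Prop :=
  ∀ (T : Over S) (g : T ⟶ G), ∃ φ : pull F T ⟶ pull F T,
    φ ≫ pullMap j T = pullMap j T ≫ (ρ.act T g).hom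

/-- A filtration `0 = E^n ⊆ E^{n-1} ⊆ ⋯ ⊆ E^0 = E` by `G`-stable submodules, each successive
quotient `E^i / E^{i+1}` being a line bundle. -/
structure EquivariantStructure.StableFlag {S : Scheme.{u}} {G : Over S} [GrpObj G] {E : S.Modules}
    (ρ : EquivariantStructure G E) (n : ℕ) where
  /-- the modules `E^i` -/
  F : Fin (n + 1) → S.Modules
  /-- the inclusions `E^i ⟶ E` -/
  toE (i : Fin (n + 1)) : F i ⟶ E
  /-- the inclusions `E^{i+1} ⟶ E^i` -/
  incl (i : Fin n) : F i.succ ⟶ F i.castSucc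
  mono_toE (i : Fin (n + 1)) : Mono (toE i)
  incl_toE (i : Fin n) : incl i ≫ toE i.castSucc = toE i.succ
  first_eq : IsIso (toE 0)
  last_eq : IsZero (F (Fin.last n))
  stable (i : Fin (n + 1)) : ρ.IsStable (toE i)
  quotient_isLineBundle (i : Fin n) : IsLineBundle (cokernel (incl i))

/-! ### Trigonalizable group schemes -/

/-- The (relatively affine) group scheme `G` over `S` is trigonalizable: it admits a faithful
`G`-equivariant vector bundle with a `G`-stable filtration whose successive quotients are
line bundles. -/
def IsTrigonalizable {S : Scheme.{u}} (G : Over S) [GrpObj G] : Prop :=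
  ∃ (E : S.Modules) (ρ : EquivariantStructure G E) (n : ℕ),
    IsVectorBundle E ∧ ρ.IsFaithful ∧ Nonempty (ρ.StableFlag n)

/-- The (relatively affine) group scheme `G` over `S` is locally trigonalizable: there is a finite
locally free surjection `f : S' ⟶ S` such that `G ×_S S'` is trigonalizable. -/
def IsLocallyTrigonalizable {S : Scheme.{u}} (G : Over S) [GrpObj G] : Prop :=
  ∃ (S' : Scheme.{u}) (f : S' ⟶ S),
    IsFinite f ∧ Flat f ∧ LocallyOfFinitePresentation f ∧ Surjective f ∧
      IsTrigonalizable ((Over.pullback f).obj G)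

/-! ### Solvable group schemes -/

/-- Solvable group schemes: those with a finite chain `G = G_0 ⊇ G_1 ⊇ ⋯ ⊇ G_t = 1` of closed
subgroup schemes, each `G_{i+1}` normal in `G_i` with `G_i / G_{i+1}` commutative, i.e. such that
the commutator map `G_i × G_i ⟶ G_i`, `(x, y) ↦ x y x⁻¹ y⁻¹`, factors through `G_{i+1}`. -/
inductive IsSolvableGroupScheme {S : Scheme.{u}} : (G : Over S) → [GrpObj G] → Prop
  | trivial (G : Over S) [GrpObj G] (h : Nonempty (G ≅ 𝟙_ (Over S))) : IsSolvableGroupScheme G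
  | step (G N : Over S) [GrpObj G] [GrpObj N] (φ : N ⟶ G)
      (closed : IsClosedImmersion φ.left) (normal : IsMonHom.Normal φ)
      (comm : ∃ c : G ⊗ G ⟶ N, c ≫ φ = GrpObj.commutator G)
      (solvable : IsSolvableGroupScheme N) : IsSolvableGroupScheme G

end TrigGroupScheme

end

/-!
The theorem says that the points of `G` can be written faithfully as upper triangular matrices,
after a change of basis over `kbar`, and then over a finite extension of `k`.

Let `H` be the Hopf algebra of functions on `G`. Every element of `H` lies in a finite-dimensional
subcomodule, and `H` is finitely generated as an algebra, so `H` is generated by the coefficients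
of one matrix `a` with `Δ a = a ⊗ a` and `ε a = 1` (`exists_generating_multiplicative_matrix`). A
`T`-valued point of `G` is a homomorphism `H → Γ(T, 𝒪_T)`, and applying it to `a` gives a faithful
representation of `G`. For mutually inverse matrices `P` and `Q` over a `k`-algebra `R`, the matrix
`Q a P` over `R ⊗ H` (`conjEntry`) represents the base change `G_R`. If it is upper triangular, the
spans of the first basis vectors of the free module form a stable flag, and `G_R` is trigonalizable
(`isTrigonalizable_of_conjEntry_eq_zero`). The entries of `P` and `Q` over an algebraic extension
generate a finite one, and the vanishing of the entries of `Q a P` descends to it by flatness, so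
both assertions follow once suitable `P` and `Q` are found over `kbar`.

If `G` is commutative, then the two projections of `Spec (H ⊗ H)` are commuting points of `G`. Hence
the scalar matrices `ξ(a)`, for all linear functionals `ξ` on `H`, commute with each other and can
be simultaneously triangularized. Since functionals separate the elements of `kbar ⊗ H`, the matrix
`Q a P` is then upper triangular (`exists_conjEntry_eq_zero_of_isMulCommutative`).

If `G` is smooth, connected and solvable, consider the group `G(kbar)` with its Zariski
topology. It is solvable. It is connected, because `G` has a rational point and therefore stays
connected over `kbar` (`connectedSpace_pullback`), and because the closed points of a connected
Jacobson space form a connected set. The argument of Lie and Kolchin triangularizes `G(kbar)`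
(`exists_conj_upperTriangular_of_isSolvable`): it needs no more than that translations and
`g ↦ g a g⁻¹` are continuous and that the zero sets of matrix coefficients are closed. As `G` is
smooth, `G_kbar` is reduced, so a function vanishing on `G(kbar)` is zero and `Q a P` is upper
triangular (`exists_conjEntry_eq_zero_of_isSolvableGroupScheme`).
-/

open CategoryTheory CategoryTheory.Limits MonoidalCategory
open CartesianMonoidalCategory AlgebraicGeometry
open scoped CategoryTheory.MonObj CategoryTheory.Obj

noncomputable section

namespace TrigGroupScheme

/-! ### Common eigenvectors of commuting endomorphisms -/

section CommonEigenvectors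

variable {K : Type*} [Field K] [IsAlgClosed K] {X : Type*}

/-- Commuting endomorphisms over an algebraically closed field have a common eigenvector. -/
theorem exists_common_eigenvector_of_commute {V : Type*} [AddCommGroup V] [Module K V]
    [FiniteDimensional K V] [Nontrivial V] (r : X → Module.End K V)
    (hr : ∀ x y, Commute (r x) (r y)) : ∃ v : V, v ≠ 0 ∧ ∀ x, ∃ c : K, r x v = c • v := by
  -- A minimal nonzero stable subspace is contained in an eigenspace of each endomorphism.
  let P : Set (Submodule K V) := {W | W ≠ ⊥ ∧ ∀ x, ∀ w ∈ W, r x w ∈ W}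
  obtain ⟨W, ⟨hW, hs⟩, hmin⟩ := wellFounded_lt.has_min P ⟨⊤, top_ne_bot, by simp⟩
  obtain ⟨v, hv, hv0⟩ := W.ne_bot_iff.1 hW
  refine ⟨v, hv0, fun x => ?_⟩
  have : Nontrivial W := Submodule.nontrivial_iff_ne_bot.2 hW
  obtain ⟨c, hc⟩ := Module.End.exists_eigenvalue ((r x).restrict (hs x))
  obtain ⟨w, hw⟩ := hc.exists_hasEigenvector
  refine ⟨c, ?_⟩
  let W' := W ⊓ Module.End.eigenspace (r x) c
  have hW' : W' ∈ P := by
    refine ⟨(Submodule.ne_bot_iff _).2 ⟨w, ⟨w.2, ?_⟩, fun h => hw.2 (Subtype.ext h)⟩, ?_⟩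
    · exact Module.End.mem_eigenspace_iff.2 congr(($(hw.apply_eq_smul) : V))
    · rintro y z ⟨hz1, hz2⟩
      refine ⟨hs y z hz1, Module.End.mem_eigenspace_iff.2 ?_⟩
      have := congr($((hr x y).eq) z)
      rw [Module.End.mul_apply, Module.End.mul_apply, Module.End.mem_eigenspace_iff.1 hz2,
        map_smul] at this
      exact this
  have h1 : W ≤ W' := by
    by_contra h
    exact hmin W' hW' (lt_of_le_of_ne inf_le_left fun h' => h h'.ge)
  exact Module.End.mem_eigenspace_iff.1 (h1 hv).2

end CommonEigenvectors

/-! ### Simultaneous triangularization -/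

section Triangular

variable {K : Type*} [Field K] {X : Type*}

/-- Let `H` be a property of families of endomorphisms which passes to quotients by stable
subspaces and ensures a common eigenvector. Families with property `H` can be simultaneously
brought into upper triangular form. -/
theorem exists_triangular_basis
    (H : (V : Type u) → [AddCommGroup V] → [Module K V] → (X → Module.End K V) → Prop)
    (eig : ∀ (V : Type u) [AddCommGroup V] [Module K V] [FiniteDimensional K V] [Nontrivial V]
      (r : X → Module.End K V), H V r → ∃ v : V, v ≠ 0 ∧ ∀ x, ∃ c : K, r x v = c • v)
    (quot : ∀ (V : Type u) [AddCommGroup V] [Module K V] (r : X → Module.End K V)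
      (W : Submodule K V) (hW : ∀ x, W ≤ W.comap (r x)), H V r →
        H (V ⧸ W) fun x => W.mapQ W (r x) (hW x))
    (n : ℕ) : ∀ (V : Type u) [AddCommGroup V] [Module K V] [FiniteDimensional K V]
    (r : X → Module.End K V), H V r → Module.finrank K V = n →
      ∃ b : Module.Basis (Fin n) K V, ∀ x i j, j < i → b.repr (r x (b j)) i = 0 := by
  induction n with
  | zero =>
    intro V _ _ _ r _ hn
    exact ⟨Module.finBasisOfFinrankEq K V hn, fun x i => i.elim0⟩
  | succ n ih =>
    intro V _ _ _ r hr hn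
    have : Nontrivial V := Module.nontrivial_of_finrank_pos (R := K) (by omega)
    obtain ⟨v, hv, hv'⟩ := eig V r hr
    obtain ⟨W, hW1, hW⟩ : ∃ W : Submodule K V, Module.finrank K W = 1 ∧
        ∀ x, W ≤ W.comap (r x) := by
      refine ⟨K ∙ v, finrank_span_singleton hv, fun x => ?_⟩
      rw [Submodule.span_singleton_le_iff_mem, Submodule.mem_comap]
      obtain ⟨c, hc⟩ := hv' x
      rw [hc]
      exact Submodule.smul_mem _ _ (Submodule.mem_span_singleton_self v)
    have hfin : Module.finrank K (V ⧸ W) = n := by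
      have h1 := W.finrank_quotient_add_finrank
      omega
    obtain ⟨b', hb'⟩ := ih (V ⧸ W) _ (quot V r W hW hr) hfin
    let bW : Module.Basis (Fin 1) K W :=
      Module.finBasisOfFinrankEq K W hW1
    let e : Fin 1 ⊕ Fin n ≃ Fin (n + 1) := finSumFinEquiv.trans (finCongr (add_comm 1 n))
    have he : ∀ j, e.symm (Fin.succ j) = Sum.inr j := fun j => by
      rw [Equiv.symm_apply_eq]
      ext
      simp [e]
    have he0 : e.symm 0 = Sum.inl 0 := by
      rw [Equiv.symm_apply_eq]
      ext
      simp [e]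
    refine ⟨(Module.Basis.sumQuot bW b').reindex e, fun x i j hij => ?_⟩
    obtain ⟨i, rfl⟩ := Fin.exists_succ_eq_of_ne_zero (Fin.ne_zero_of_lt hij)
    rw [Module.Basis.repr_reindex_apply, Module.Basis.reindex_apply, he]
    cases j using Fin.cases with
    | zero =>
      have hmem : r x (bW 0) ∈ W := Submodule.mem_comap.1 (hW x (bW 0).2)
      rw [he0, Module.Basis.sumQuot_inl, Module.Basis.sumQuot_repr_inr, Submodule.mkQ_apply,
        (Submodule.Quotient.mk_eq_zero W).2 hmem, map_zero, Finsupp.zero_apply]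
    | succ j =>
      rw [he, Module.Basis.sumQuot_repr_inr]
      have h : W.mkQ (r x (Module.Basis.sumQuot bW b' (Sum.inr j))) =
          W.mapQ W (r x) (hW x) (b' j) := by
        rw [← Module.Basis.sumQuot_inr bW b' j]
        rfl
      have h2 := hb' x i j (Fin.succ_lt_succ_iff.1 hij)
      beta_reduce at h2
      rw [← h] at h2
      exact h2

end Triangular

/-! ### The theorem of Lie and Kolchin -/

section LieKolchin

open scoped commutatorElement

/-- If finitely many closed sets, pairwise disjoint on a preconnected set `S`, cover `S`, then each
of them which meets `S` contains `S`. -/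
lemma subset_of_isPreconnected_of_finite_cover {X C : Type*} [TopologicalSpace X] {S : Set X}
    (hS : IsPreconnected S) (Z : C → Set X) (hZ : ∀ c, IsClosed (Z c)) {T : Set C} (hT : T.Finite)
    (hcov : ∀ x ∈ S, ∃ c ∈ T, x ∈ Z c) (hdisj : ∀ x ∈ S, ∀ c c', x ∈ Z c → x ∈ Z c' → c = c')
    {x₀ : X} (hx₀ : x₀ ∈ S) {c₀ : C} (h₀ : x₀ ∈ Z c₀) : S ⊆ Z c₀ := by
  have hB : IsClosed (⋃ c ∈ T \ {c₀}, Z c) :=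
    (hT.subset Set.sdiff_subset).isClosed_biUnion fun c _ => hZ c
  intro y hy
  by_contra hyZ
  obtain ⟨z, hzS, hz, hz'⟩ := isPreconnected_closed_iff.1 hS (Z c₀) _ (hZ c₀) hB (by
    intro x hx
    obtain ⟨c, hc, hxc⟩ := hcov x hx
    by_cases h : c = c₀
    · exact Or.inl (h ▸ hxc)
    · exact Or.inr (Set.mem_biUnion ⟨hc, h⟩ hxc)) ⟨x₀, hx₀, h₀⟩ (by
    obtain ⟨c, hc, hxc⟩ := hcov y hy
    exact ⟨y, hy, Set.mem_biUnion ⟨hc, fun h => hyZ (h ▸ hxc)⟩ hxc⟩)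
  simp only [Set.mem_iUnion] at hz'
  obtain ⟨c, ⟨_, hc⟩, hzc⟩ := hz'
  exact hc (hdisj z hzS c c₀ hzc hz)

/-- A topology on a group for which translations and the maps `g ↦ g a g⁻¹` are continuous. The
Zariski topology on the rational points of a group scheme is of this kind, although the
multiplication need not be continuous for the product topology. -/
class IsSemitopologicalGroup (Γ : Type*) [Group Γ] [TopologicalSpace Γ] : Prop where
  continuous_mul_left (a : Γ) : Continuous fun g : Γ => a * g
  continuous_mul_right (a : Γ) : Continuous fun g : Γ => g * a
  continuous_conj (a : Γ) : Continuous fun g : Γ => g * a * g⁻¹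

variable {Γ : Type*} [Group Γ] [TopologicalSpace Γ]

/-- The commutators `⁅g, b⁆` with fixed `b` form a connected set through `1`, and these sets
generate the commutator subgroup. -/
lemma isPreconnected_commutator [IsSemitopologicalGroup Γ] {D : Subgroup Γ}
    (hD : IsPreconnected (D : Set Γ)) : IsPreconnected ((⁅D, D⁆ : Subgroup Γ) : Set Γ) := by
  refine isPreconnected_of_forall 1 fun x hx => ?_
  rw [SetLike.mem_coe, Subgroup.commutator_def] at hx
  induction hx using Subgroup.closure_induction with
  | mem x hx =>
    obtain ⟨a, ha, b, hb, rfl⟩ := hx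
    refine ⟨(fun g => ⁅g, b⁆) '' D, ?_, ⟨1, D.one_mem, by simp⟩, ⟨a, ha, rfl⟩, ?_⟩
    · rintro _ ⟨g, hg, rfl⟩
      exact Subgroup.commutator_mem_commutator hg hb
    · refine hD.image _ (Continuous.continuousOn ?_)
      exact (IsSemitopologicalGroup.continuous_mul_right b⁻¹).comp
        (IsSemitopologicalGroup.continuous_conj b)
  | one => exact ⟨{1}, by simp, rfl, rfl, isPreconnected_singleton⟩
  | mul x y hx _ h1 h2 =>
    obtain ⟨P, hP, h1P, hxP, hPc⟩ := h1
    obtain ⟨Q, hQ, h1Q, hyQ, hQc⟩ := h2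
    rw [← Subgroup.commutator_def] at hx
    refine ⟨P ∪ (fun g => x * g) '' Q, ?_, Or.inl h1P, Or.inr ⟨y, hyQ, rfl⟩, ?_⟩
    · rintro _ (h | ⟨g, hg, rfl⟩)
      · exact hP h
      · exact Subgroup.mul_mem _ hx (hQ hg)
    · exact IsPreconnected.union x hxP ⟨1, h1Q, mul_one x⟩ hPc
        (hQc.image _ (IsSemitopologicalGroup.continuous_mul_left x).continuousOn)
  | inv x hx h1 =>
    obtain ⟨P, hP, h1P, hxP, hPc⟩ := h1
    rw [← Subgroup.commutator_def] at hx
    refine ⟨(fun g => x⁻¹ * g) '' P, ?_, ⟨x, hxP, inv_mul_cancel x⟩, ⟨1, h1P, mul_one _⟩, ?_⟩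
    · rintro _ ⟨g, hg, rfl⟩
      exact Subgroup.mul_mem _ (Subgroup.inv_mem _ hx) (hP hg)
    · exact hPc.image _ (IsSemitopologicalGroup.continuous_mul_left _).continuousOn

variable {K V : Type*} [Field K] [AddCommGroup V] [Module K V]

/-- A representation of a group with a topology is Zariski continuous if the zero sets of its matrix
coefficients are closed. -/
def IsZariskiContinuous (r : Γ →* Module.End K V) : Prop :=
  ∀ (v : V) (l : V →ₗ[K] K) (c : K), IsClosed {g | l (r g v) = c}

lemma IsZariskiContinuous.isClosed_setOf_eq {r : Γ →* Module.End K V}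
    (hr : IsZariskiContinuous r) (v w : V) : IsClosed {g | r g v = w} := by
  have : {g | r g v = w} = ⋂ l : V →ₗ[K] K, {g | l (r g v) = l w} := by
    ext g
    simp only [Set.mem_ofPred_eq, Set.mem_iInter]
    rw [← sub_eq_zero, ← Module.forall_dual_apply_eq_zero_iff K (V := V)]
    simp [sub_eq_zero]
  rw [this]
  exact isClosed_iInter fun l => hr v l (l w)

lemma IsZariskiContinuous.isClosed_setOf_eigen {r : Γ →* Module.End K V}
    (hr : IsZariskiContinuous r) (f : Module.End K V) (v : V) (c : K) :
    IsClosed {g | f (r g v) = c • r g v} := by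
  have : {g | f (r g v) = c • r g v} =
      ⋂ l : V →ₗ[K] K, {g | (l ∘ₗ (f - algebraMap K _ c)) (r g v) = 0} := by
    ext g
    simp only [Set.mem_ofPred_eq, Set.mem_iInter, LinearMap.comp_apply]
    rw [Module.forall_dual_apply_eq_zero_iff K (V := V), LinearMap.sub_apply, sub_eq_zero]
    rfl
  rw [this]
  exact isClosed_iInter fun l => hr v _ 0

variable [IsSemitopologicalGroup Γ] [IsAlgClosed K] [FiniteDimensional K V]

/-- The inductive step of the theorem of Lie and Kolchin: if the commutator subgroup of a connected
group has a common eigenvector, so has the group. -/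
lemma exists_common_eigenvector_of_commutator {r : Γ →* Module.End K V}
    (hr : IsZariskiContinuous r) {G : Subgroup Γ} (hG : IsPreconnected (G : Set Γ))
    (hD : ∃ v : V, v ≠ 0 ∧ ∀ d ∈ ⁅G, G⁆, ∃ c : K, r d v = c • v) :
    ∃ v : V, v ≠ 0 ∧ ∀ g ∈ G, ∃ c : K, r g v = c • v := by
  obtain ⟨v, hv, hχ⟩ := hD
  choose! χ hχ using hχ
  have rinj : ∀ g (w : V), r g w = 0 → w = 0 := fun g w h => by
    have := congr(r g⁻¹ $h)
    rwa [← Module.End.mul_apply, ← map_mul, inv_mul_cancel, map_one, map_zero,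
      Module.End.one_apply] at this
  have hDG : ⁅G, G⁆ ≤ G := Subgroup.commutator_le_self G
  have hconj : ∀ g ∈ G, ∀ d ∈ ⁅G, G⁆, g⁻¹ * d * g ∈ ⁅G, G⁆ := by
    intro g hg d hd
    have h := Subgroup.mul_mem _
      (Subgroup.commutator_mem_commutator (G.inv_mem hg) (hDG hd)) hd
    simpa [commutatorElement_def] using h
  have hmove : ∀ g d (w : V), r d (r g w) = r g (r (g⁻¹ * d * g) w) := fun g d w => by
    rw [← Module.End.mul_apply, ← Module.End.mul_apply, ← map_mul, ← map_mul]
    group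
  -- The eigenvalue of `g⁻¹ d g` is an eigenvalue of `d`, of which there are finitely many.
  have hinv : ∀ d ∈ ⁅G, G⁆, ∀ g ∈ G, χ (g⁻¹ * d * g) = χ d := by
    intro d hd g hg
    have hmem : ∀ g ∈ G, r d (r g v) = χ (g⁻¹ * d * g) • r g v := by
      intro g hg
      rw [hmove, hχ _ (hconj g hg d hd), map_smul]
    have hne : ∀ g, r g v ≠ 0 := fun g h => hv (rinj g v h)
    have := subset_of_isPreconnected_of_finite_cover hG
      (fun c => {g | r d (r g v) = c • r g v}) (fun c => hr.isClosed_setOf_eigen (r d) v c)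
      (T := {c | (r d).HasEigenvalue c}) (Module.End.finite_hasEigenvalue (r d))
      (fun g hg => ⟨χ (g⁻¹ * d * g), Module.End.hasEigenvalue_of_hasEigenvector
        ⟨Module.End.mem_eigenspace_iff.2 (hmem g hg), hne g⟩, hmem g hg⟩)
      (fun g _ c c' h h' => smul_left_injective K (hne g) (h.symm.trans h'))
      (x₀ := 1) G.one_mem (c₀ := χ d) (by simpa using hχ d hd) hg
    exact smul_left_injective K (hne g) ((hmem g hg).symm.trans this)
  -- The eigenspace of the commutator subgroup is stable.
  let W : Submodule K V := ⨅ d : (⁅G, G⁆ : Subgroup Γ), Module.End.eigenspace (r d) (χ d)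
  have hWmem : ∀ w, w ∈ W ↔ ∀ d ∈ ⁅G, G⁆, r d w = χ d • w := by
    intro w
    simp [W, Submodule.mem_iInf]
  have hWG : ∀ g : G, ∀ w ∈ W, r g w ∈ W := by
    intro g w hw
    rw [hWmem] at hw ⊢
    intro d hd
    rw [hmove, hw _ (hconj g g.2 d hd), map_smul, hinv d hd g g.2]
  have hvW : v ∈ W := (hWmem v).2 hχ
  have : Nontrivial W := ⟨⟨v, hvW⟩, 0, fun h => hv congr(($h : V))⟩
  let s : G →* Module.End K W :=
    { toFun g := (r g).restrict (hWG g)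
      map_one' := by ext w; simp
      map_mul' g h := by ext w; simp }
  have hs : ∀ g (w : W), (s g w : V) = r g w := fun g w => rfl
  -- On it a commutator acts through a scalar of determinant one.
  have hdet : ∀ d (hd : d ∈ ⁅G, G⁆), χ d ^ Module.finrank K W = 1 := by
    intro d hd
    have h1 : (⟨d, hDG hd⟩ : G) ∈ commutator G := by
      have h2 := Subgroup.map_subtype_commutator G
      rw [← h2] at hd
      obtain ⟨d', hd', h3⟩ := hd
      have : (⟨d, hDG hd⟩ : G) = d' := Subtype.ext h3.symm
      rwa [this]
    have h2 := Abelianization.commutator_subset_ker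
      ((LinearMap.det (M := W) (A := K)).comp s).toHomUnits h1
    have h3 : LinearMap.det (s ⟨d, hDG hd⟩) = 1 := congr((($h2 : Kˣ) : K))
    have h4 : s ⟨d, hDG hd⟩ = χ d • LinearMap.id := by
      ext w
      exact (hWmem w).1 w.2 d hd
    rwa [h4, LinearMap.det_smul, LinearMap.det_id, mul_one] at h3
  classical
  -- By connectedness these roots of unity are all `1`.
  have hone : ∀ d ∈ ⁅G, G⁆, χ d = 1 := by
    intro d hd
    have hne : ∀ g, r g v ≠ 0 := fun g h => hv (rinj g v h)
    have := subset_of_isPreconnected_of_finite_cover (isPreconnected_commutator hG)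
      (fun c => {g | r g v = c • v}) (fun c => hr.isClosed_setOf_eq v (c • v))
      (T := {c | c ^ Module.finrank K W = 1})
      ((Polynomial.nthRoots (Module.finrank K W) (1 : K)).toFinset.finite_toSet.subset
        fun c hc => by
        rwa [Finset.mem_coe, Multiset.mem_toFinset, Polynomial.mem_nthRoots Module.finrank_pos])
      (fun g hg => ⟨χ g, hdet g hg, hχ g hg⟩)
      (fun g _ c c' h h' => smul_left_injective K hv (h.symm.trans h'))
      (x₀ := 1) (Subgroup.one_mem _) (c₀ := 1) (by simp) hd
    exact smul_left_injective K hv ((hχ d hd).symm.trans this)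
  obtain ⟨w, hw, hw'⟩ := exists_common_eigenvector_of_commute s (fun g h => by
    have h1 : ∀ d : G, (d : Γ) ∈ ⁅G, G⁆ → s d = 1 := by
      intro d hd
      ext w
      rw [hs, (hWmem w).1 w.2 d hd, hone d hd, one_smul]
      rfl
    have h2 := h1 ⁅g, h⁆ (Subgroup.commutator_mem_commutator g.2 h.2)
    have h3 : g * h = ⁅g, h⁆ * (h * g) := by rw [commutatorElement_def]; group
    rw [Commute, SemiconjBy, ← map_mul, ← map_mul, h3, map_mul, h2, one_mul])
  refine ⟨w, fun h => hw (Subtype.ext h), fun g hg => ?_⟩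
  obtain ⟨c, hc⟩ := hw' ⟨g, hg⟩
  exact ⟨c, congr(($hc : V))⟩

/-- **Lie–Kolchin**: a connected solvable group has a common eigenvector in each nonzero
finite-dimensional representation with Zariski closed conditions. -/
theorem exists_common_eigenvector_of_isSolvable [ConnectedSpace Γ] [Group.IsSolvable Γ]
    [Nontrivial V]
    (r : Γ →* Module.End K V) (hr : IsZariskiContinuous r) :
    ∃ v : V, v ≠ 0 ∧ ∀ g, ∃ c : K, r g v = c • v := by
  have hconn : ∀ n, IsPreconnected (derivedSeries Γ n : Set Γ) := by
    intro n
    induction n with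
    | zero => exact isPreconnected_univ
    | succ n ih => exact isPreconnected_commutator ih
  obtain ⟨N, hN⟩ := Group.IsSolvable.solvable (G := Γ)
  have key : ∀ m ≤ N, ∃ v : V, v ≠ 0 ∧ ∀ g ∈ derivedSeries Γ (N - m), ∃ c : K, r g v = c • v := by
    intro m
    induction m with
    | zero =>
      intro _
      obtain ⟨v, hv⟩ := exists_ne (0 : V)
      refine ⟨v, hv, fun g hg => ⟨1, ?_⟩⟩
      rw [Nat.sub_zero, hN, Subgroup.mem_bot] at hg
      simp [hg]
    | succ m ih =>
      intro hm
      refine exists_common_eigenvector_of_commutator hr (hconn _) ?_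
      have h := ih (by omega)
      rwa [show N - m = N - (m + 1) + 1 by omega, derivedSeries_succ] at h
  obtain ⟨v, hv, h⟩ := key N le_rfl
  refine ⟨v, hv, fun g => h g ?_⟩
  simp

end LieKolchin

/-! ### Conjugation of matrices into upper triangular form -/

section Matrices

variable {K : Type u} [Field K] {n : ℕ} {X : Type*}

lemma exists_conj_upperTriangular_of_basis (A : X → Matrix (Fin n) (Fin n) K)
    (b : Module.Basis (Fin n) K (Fin n → K))
    (hb : ∀ x i j, j < i → b.repr (Matrix.toLin' (A x) (b j)) i = 0) :
    ∃ P Q : Matrix (Fin n) (Fin n) K, P * Q = 1 ∧ ∀ x i j, j < i → (Q * A x * P) i j = 0 := by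
  refine ⟨(Pi.basisFun K (Fin n)).toMatrix b, b.toMatrix (Pi.basisFun K (Fin n)),
    Module.Basis.toMatrix_mul_toMatrix_flip _ _, fun x i j hij => ?_⟩
  have h := basis_toMatrix_mul_linearMap_toMatrix_mul_basis_toMatrix b (Pi.basisFun K (Fin n)) b
    (Pi.basisFun K (Fin n)) (Matrix.toLin' (A x))
  rw [← Matrix.toLin_eq_toLin', LinearMap.toMatrix_toLin] at h
  rw [h, LinearMap.toMatrix_apply, Matrix.toLin_eq_toLin']
  exact hb x i j hij

variable [IsAlgClosed K]

/-- Commuting matrices over an algebraically closed field are simultaneously triangularizable. -/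
theorem exists_conj_upperTriangular_of_commute (A : X → Matrix (Fin n) (Fin n) K)
    (hA : ∀ x y, Commute (A x) (A y)) :
    ∃ P Q : Matrix (Fin n) (Fin n) K, P * Q = 1 ∧ ∀ x i j, j < i → (Q * A x * P) i j = 0 := by
  obtain ⟨b, hb⟩ := exists_triangular_basis (X := X)
    (fun V _ _ r => ∀ x y, Commute (r x) (r y))
    (fun V _ _ _ _ r hr => exists_common_eigenvector_of_commute r hr)
    (fun V _ _ r W hW hr x y => by
      refine LinearMap.ext fun v => ?_
      obtain ⟨v, rfl⟩ := W.mkQ_surjective v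
      exact congr(W.mkQ ($((hr x y).eq) v)))
    n (Fin n → K) (fun x => Matrix.toLin' (A x))
    (fun x y => by
      rw [Commute, SemiconjBy, Module.End.mul_eq_comp, Module.End.mul_eq_comp, ← Matrix.toLin'_mul,
        ← Matrix.toLin'_mul, (hA x y).eq])
    (by simp)
  exact exists_conj_upperTriangular_of_basis A b hb

/-- The matrices of a Zariski continuous representation of a connected solvable group are
simultaneously triangularizable. -/
theorem exists_conj_upperTriangular_of_isSolvable {Γ : Type*} [Group Γ] [TopologicalSpace Γ]
    [IsSemitopologicalGroup Γ] [ConnectedSpace Γ] [Group.IsSolvable Γ]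
    (A : Γ →* Matrix (Fin n) (Fin n) K)
    (hA : ∀ (C : Matrix (Fin n) (Fin n) K) (c : K), IsClosed {g | ∑ i, ∑ j, C i j * A g i j = c}) :
    ∃ P Q : Matrix (Fin n) (Fin n) K, P * Q = 1 ∧ ∀ g i j, j < i → (Q * A g * P) i j = 0 := by
  obtain ⟨b, hb⟩ := exists_triangular_basis (X := Γ)
    (fun V _ _ r => ∃ s : Γ →* Module.End K V, (∀ g, s g = r g) ∧ IsZariskiContinuous s)
    (fun V _ _ _ _ r ⟨s, hs, hr⟩ => by
      simp only [← hs]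
      exact exists_common_eigenvector_of_isSolvable s hr)
    (fun V _ _ r W hW ⟨s, hs, hr⟩ => by
      refine ⟨⟨⟨fun g => W.mapQ W (r g) (hW g), ?_⟩, fun g h => ?_⟩, fun g => rfl, ?_⟩
      · refine LinearMap.ext fun v => ?_
        obtain ⟨v, rfl⟩ := W.mkQ_surjective v
        change W.mkQ (r 1 v) = W.mkQ v
        rw [← hs, map_one, Module.End.one_apply]
      · refine LinearMap.ext fun v => ?_
        obtain ⟨v, rfl⟩ := W.mkQ_surjective v
        change W.mkQ (r (g * h) v) = W.mkQ (r g (r h v))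
        rw [← hs, ← hs, ← hs, map_mul, Module.End.mul_apply]
      · intro v l c
        obtain ⟨v, rfl⟩ := W.mkQ_surjective v
        have := hr v (l ∘ₗ W.mkQ) c
        simp only [hs] at this
        exact this)
    n (Fin n → K) (fun g => Matrix.toLin' (A g))
    ⟨((Matrix.toLinAlgEquiv' : Matrix (Fin n) (Fin n) K ≃ₐ[K] _) : _ →* _).comp A, fun g => rfl, by
      intro v l c
      convert hA (fun i j => l (Pi.single i 1) * v j) c using 3 with g
      change l ((A g).mulVec v) = c ↔ _
      rw [show (A g).mulVec v = ∑ i, (∑ j, A g i j * v j) • Pi.single (M := fun _ => K) i 1 by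
        ext i; simp [Matrix.mulVec, dotProduct, Finset.sum_apply, Pi.single_apply]]
      rw [map_sum]
      simp only [map_smul, smul_eq_mul, Finset.sum_mul]
      simp only [mul_comm, mul_assoc, mul_left_comm]⟩
    (by simp)
  exact exists_conj_upperTriangular_of_basis A b hb

end Matrices

/-! ### Finite-dimensional subcomodules of a Hopf algebra -/

section Coalgebra

open TensorProduct Coalgebra

variable {k H : Type*} [Field k]

section
variable [AddCommGroup H] [Module k H] [Coalgebra k H]

/-- Right translation by a functional: `x ↦ ∑ x₁ ξ(x₂)`. -/
def rightAct (f : H →ₗ[k] k) : H →ₗ[k] H :=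
  (TensorProduct.rid k H).toLinearMap ∘ₗ f.lTensor H ∘ₗ comul

/-- Left translation by a functional: `x ↦ ∑ ξ(x₁) x₂`. -/
def leftAct (f : H →ₗ[k] k) : H →ₗ[k] H :=
  (TensorProduct.lid k H).toLinearMap ∘ₗ f.rTensor H ∘ₗ comul

lemma rightAct_counit : rightAct (counit : H →ₗ[k] k) = LinearMap.id := by
  ext x
  simp [rightAct]

lemma leftAct_counit : leftAct (counit : H →ₗ[k] k) = LinearMap.id := by
  ext x
  simp [leftAct]

lemma comul_rightAct (f : H →ₗ[k] k) (x : H) :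
    comul (R := k) (rightAct f x) = (rightAct f).lTensor H (comul (R := k) x) := by
  have h1 : ∀ t : H ⊗[k] H, comul (R := k) (TensorProduct.rid k H (f.lTensor H t)) =
      TensorProduct.rid k (H ⊗[k] H) (f.lTensor (H ⊗[k] H) ((comul (R := k)).rTensor H t)) := by
    intro t
    induction t with
    | zero => simp
    | add a b ha hb => simp only [map_add, ha, hb]
    | tmul a b => simp
  have h2 : ∀ (a : H) (t : H ⊗[k] H), TensorProduct.rid k (H ⊗[k] H)
      (f.lTensor (H ⊗[k] H) ((TensorProduct.assoc k H H H).symm (a ⊗ₜ t))) =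
        a ⊗ₜ TensorProduct.rid k H (f.lTensor H t) := by
    intro a t
    induction t with
    | zero => simp
    | add b c hb hc => simp only [map_add, tmul_add, hb, hc]
    | tmul b c => simp
  have h3 : ∀ t : H ⊗[k] H, TensorProduct.rid k (H ⊗[k] H) (f.lTensor (H ⊗[k] H)
      ((TensorProduct.assoc k H H H).symm ((comul (R := k)).lTensor H t))) =
        (rightAct f).lTensor H t := by
    intro t
    induction t with
    | zero => simp
    | add a b ha hb => simp only [map_add, ha, hb]
    | tmul a b => simp only [LinearMap.lTensor_tmul, h2]; rfl
  rw [← h3, ← Coalgebra.coassoc_apply, LinearEquiv.symm_apply_apply, ← h1]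
  rfl

lemma comul_leftAct (f : H →ₗ[k] k) (x : H) :
    comul (R := k) (leftAct f x) = (leftAct f).rTensor H (comul (R := k) x) := by
  have h1 : ∀ t : H ⊗[k] H, comul (R := k) (TensorProduct.lid k H (f.rTensor H t)) =
      TensorProduct.lid k (H ⊗[k] H) (f.rTensor (H ⊗[k] H) ((comul (R := k)).lTensor H t)) := by
    intro t
    induction t with
    | zero => simp
    | add a b ha hb => simp only [map_add, ha, hb]
    | tmul a b => simp
  have h2 : ∀ (a : H) (t : H ⊗[k] H), TensorProduct.lid k (H ⊗[k] H)
      (f.rTensor (H ⊗[k] H) (TensorProduct.assoc k H H H (t ⊗ₜ a))) =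
        TensorProduct.lid k H (f.rTensor H t) ⊗ₜ a := by
    intro a t
    induction t with
    | zero => simp
    | add b c hb hc => simp only [map_add, add_tmul, hb, hc]
    | tmul b c => simp [smul_tmul']
  have h3 : ∀ t : H ⊗[k] H, TensorProduct.lid k (H ⊗[k] H) (f.rTensor (H ⊗[k] H)
      (TensorProduct.assoc k H H H ((comul (R := k)).rTensor H t))) =
        (leftAct f).rTensor H t := by
    intro t
    induction t with
    | zero => simp
    | add a b ha hb => simp only [map_add, ha, hb]
    | tmul a b => simp only [LinearMap.rTensor_tmul, h2]; rfl
  rw [← h3, Coalgebra.coassoc_apply, ← h1]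
  rfl

lemma rightAct_rightAct (f g : H →ₗ[k] k) (x : H) :
    rightAct g (rightAct f x) = rightAct (g ∘ₗ rightAct f) x := by
  change TensorProduct.rid k H (g.lTensor H (comul (R := k) (rightAct f x))) = _
  rw [comul_rightAct, ← LinearMap.comp_apply, ← LinearMap.lTensor_comp]
  rfl

lemma counit_leftAct (f : H →ₗ[k] k) (x : H) : counit (R := k) (leftAct f x) = f x := by
  have h : ∀ t : H ⊗[k] H, counit (R := k) (TensorProduct.lid k H (f.rTensor H t)) =
      f (TensorProduct.rid k H ((counit (R := k)).lTensor H t)) := by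
    intro t
    induction t with
    | zero => simp
    | add a b ha hb => simp only [map_add, ha, hb]
    | tmul a b => simp [mul_comm]
  change counit (R := k) (TensorProduct.lid k H (f.rTensor H (comul x))) = _
  rw [h]
  simp

/-- The coefficients `∑ x₁ ξ(x₂)` of `x`, for all functionals `ξ`, form the subcomodule generated by
`x`. -/
def coeffSpace (x : H) : Submodule k H :=
  Submodule.span k (Set.range fun f : H →ₗ[k] k => rightAct f x)

lemma mem_coeffSpace_self (x : H) : x ∈ coeffSpace (k := k) x :=
  Submodule.subset_span ⟨counit, by simp [rightAct_counit]⟩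

lemma rightAct_mem_coeffSpace (f : H →ₗ[k] k) {x y : H} (hy : y ∈ coeffSpace (k := k) x) :
    rightAct f y ∈ coeffSpace (k := k) x := by
  induction hy using Submodule.span_induction with
  | mem y hy =>
    obtain ⟨g, rfl⟩ := hy
    exact Submodule.subset_span ⟨_, (rightAct_rightAct g f x).symm⟩
  | zero => simp
  | add a b _ _ ha hb => rw [map_add]; exact Submodule.add_mem _ ha hb
  | smul c a _ ha => rw [map_smul]; exact Submodule.smul_mem _ _ ha

lemma finiteDimensional_coeffSpace (x : H) : FiniteDimensional k (coeffSpace (k := k) x) := by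
  classical
  obtain ⟨s, hs⟩ := TensorProduct.exists_finset (comul (R := k) x)
  have hle : coeffSpace (k := k) x ≤ Submodule.span k (s.image Prod.fst : Set H) := by
    refine Submodule.span_le.2 ?_
    rintro _ ⟨f, rfl⟩
    change TensorProduct.rid k H (f.lTensor H (comul (R := k) x)) ∈ _
    rw [hs, map_sum, map_sum]
    refine Submodule.sum_mem _ fun p hp => ?_
    simp only [LinearMap.lTensor_tmul, TensorProduct.rid_tmul]
    exact Submodule.smul_mem _ _ (Submodule.subset_span (by
      simpa using ⟨p.2, hp⟩))
  have := FiniteDimensional.span_finset k (s.image Prod.fst)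
  exact Submodule.finiteDimensional_of_le hle

/-- A finite-dimensional subspace stable under right translations has a basis for which the matrix
coefficients `a i j` satisfy `Δ (v j) = ∑ v i ⊗ a i j`. -/
lemma exists_matrix_of_stable (V : Submodule k H) [FiniteDimensional k V]
    (hV : ∀ (f : H →ₗ[k] k), ∀ v ∈ V, rightAct f v ∈ V) :
    ∃ (n : ℕ) (a : Matrix (Fin n) (Fin n) H),
      (∀ i j, comul (R := k) (a i j) = ∑ l, a i l ⊗ₜ[k] a l j) ∧
      (∀ i j, counit (R := k) (a i j) = (1 : Matrix (Fin n) (Fin n) k) i j) ∧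
      V ≤ Submodule.span k (Set.range fun p : Fin n × Fin n => a p.1 p.2) := by
  let n := Module.finrank k V
  let b : Module.Basis (Fin n) k V := Module.finBasis k V
  obtain ⟨q, hq⟩ := V.subtype.exists_leftInverse_of_injective V.ker_subtype
  let f : Fin n → H →ₗ[k] k := fun i => b.coord i ∘ₗ q
  have hf : ∀ v ∈ V, v = ∑ i, f i v • (b i : H) := by
    intro v hv
    have h1 : q v = ⟨v, hv⟩ := congr($hq ⟨v, hv⟩)
    have h2 := congr(V.subtype $(b.sum_repr ⟨v, hv⟩))
    rw [map_sum] at h2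
    simp only [f, LinearMap.comp_apply, h1]
    exact h2.symm
  have hfb : ∀ i j, f i (b j) = (1 : Matrix (Fin n) (Fin n) k) i j := by
    intro i j
    have h1 : q (b j) = b j := congr($hq (b j))
    simp [f, h1, Finsupp.single_apply, Matrix.one_apply, eq_comm]
  let a : Matrix (Fin n) (Fin n) H := fun i j => leftAct (f i) (b j)
  have key : ∀ v ∈ V, comul (R := k) v = ∑ i, (b i : H) ⊗ₜ[k] leftAct (f i) v := by
    intro v hv
    let p : H →ₗ[k] H := ∑ i, (f i).smulRight (b i : H)
    have hp : ∀ w ∈ V, p w = w := fun w hw => by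
      conv_rhs => rw [hf w hw]
      simp [p]
    have h1 : p.rTensor H (comul (R := k) v) = comul (R := k) v := by
      classical
      let B := Module.Basis.ofVectorSpace k H
      apply (TensorProduct.equivFinsuppOfBasisRight (M := H) B).injective
      ext s
      rw [TensorProduct.equivFinsuppOfBasisRight_apply,
        TensorProduct.equivFinsuppOfBasisRight_apply]
      have h2 : ∀ t : H ⊗[k] H, TensorProduct.rid k H ((B.coord s).lTensor H (p.rTensor H t)) =
          p (TensorProduct.rid k H ((B.coord s).lTensor H t)) := by
        intro t
        induction t with
        | zero => simp
        | add x y hx hy => simp only [map_add, hx, hy]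
        | tmul x y => simp
      rw [h2]
      exact hp _ (hV _ v hv)
    rw [← h1]
    have h2 : ∀ t : H ⊗[k] H, p.rTensor H t =
        ∑ i, (b i : H) ⊗ₜ[k] TensorProduct.lid k H ((f i).rTensor H t) := by
      intro t
      induction t with
      | zero => simp
      | add x y hx hy => simp only [map_add, hx, hy, tmul_add, Finset.sum_add_distrib]
      | tmul x y => simp [p, sum_tmul, smul_tmul]
    exact h2 _
  refine ⟨n, a, fun i j => ?_, fun i j => ?_, fun v hv => ?_⟩
  · rw [comul_leftAct, key (b j) (b j).2, map_sum]
    rfl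
  · rw [counit_leftAct, hfb]
  · have h1 : v = ∑ i, counit (R := k) (b i : H) • leftAct (f i) v := by
      have h2 : leftAct (counit (R := k)) v = v := by rw [leftAct_counit]; rfl
      conv_lhs => rw [← h2]
      change TensorProduct.lid k H ((counit (R := k)).rTensor H (comul (R := k) v)) = _
      rw [key v hv]
      simp
    rw [h1]
    refine Submodule.sum_mem _ fun i _ => Submodule.smul_mem _ _ ?_
    rw [hf v hv, map_sum]
    refine Submodule.sum_mem _ fun j _ => ?_
    rw [map_smul]
    exact Submodule.smul_mem _ _ (Submodule.subset_span ⟨(i, j), rfl⟩)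

end

/-- A finitely generated commutative bialgebra over a field is generated by the coefficients of a
multiplicative matrix. -/
theorem exists_generating_multiplicative_matrix [CommRing H] [Bialgebra k H]
    [Algebra.FiniteType k H] :
    ∃ (n : ℕ) (a : Matrix (Fin n) (Fin n) H),
      (∀ i j, comul (R := k) (a i j) = ∑ l, a i l ⊗ₜ[k] a l j) ∧
      (∀ i j, counit (R := k) (a i j) = (1 : Matrix (Fin n) (Fin n) k) i j) ∧
      Algebra.adjoin k (Set.range fun p : Fin n × Fin n => a p.1 p.2) = ⊤ := by
  obtain ⟨s, hs⟩ := Algebra.FiniteType.out (R := k) (A := H)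
  let V : Submodule k H := ⨆ x : s, coeffSpace (k := k) (x : H)
  have : ∀ x : H, FiniteDimensional k (coeffSpace (k := k) x) := finiteDimensional_coeffSpace
  have : FiniteDimensional k V := inferInstance
  obtain ⟨n, a, h1, h2, h3⟩ := exists_matrix_of_stable V (by
    intro f v hv
    induction hv using Submodule.iSup_induction' with
    | mem x y hy => exact Submodule.mem_iSup_of_mem x (rightAct_mem_coeffSpace f hy)
    | zero => simp
    | add x y _ _ hx hy => rw [map_add]; exact Submodule.add_mem _ hx hy)
  refine ⟨n, a, h1, h2, top_le_iff.1 ?_⟩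
  rw [← hs]
  refine Algebra.adjoin_le fun x hx => ?_
  exact Algebra.span_le_adjoin k _ (h3 (Submodule.mem_iSup_of_mem ⟨x, hx⟩ (mem_coeffSpace_self x)))

end Coalgebra

/-! ### Scalar multiplication on modules over a scheme -/

section Scalars
variable {X Y : Scheme.{u}}

/-- The restriction of a global function to an open subset. -/
abbrev resTop (U : X.Opens) : Γ(X, ⊤) →+* Γ(X, U) :=
  (X.presheaf.map (homOfLE le_top : U ⟶ ⊤).op).hom

/-- Multiplication by a global function `a`, as an endomorphism of an `𝒪_X`-module. -/
def smulEnd (M : X.Modules) (a : Γ(X, ⊤)) : M ⟶ M :=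
  ⟨PresheafOfModules.homMk (M₁ := M.val) (M₂ := M.val)
    { app U := M.smul (resTop U.unop a)
      naturality U V i := by
        have := Scheme.Modules.map_comp_smul (M := M) i.unop (resTop U.unop a)
        refine Eq.trans ?_ this.symm
        congr 2
        simp only [resTop, ← CommRingCat.comp_apply, ← Functor.map_comp]
        rfl } (by
      intro U r m
      exact smul_comm (resTop U.unop a) (show Γ(X, U.unop) from r) (show Γ(M, U.unop) from m))⟩

lemma smulEnd_app (M : X.Modules) (a : Γ(X, ⊤)) (U : X.Opens) (x : Γ(M, U)) :
    (smulEnd M a).app U x = resTop U a • x := rfl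

lemma smulEnd_comp {M N : X.Modules} (a : Γ(X, ⊤)) (φ : M ⟶ N) :
    smulEnd M a ≫ φ = φ ≫ smulEnd N a := by
  ext U x
  simp [smulEnd_app]

lemma smulEnd_mul (M : X.Modules) (a b : Γ(X, ⊤)) :
    smulEnd M (a * b) = smulEnd M a ≫ smulEnd M b := by
  ext U x
  change resTop U (a * b) • x = resTop U b • resTop U a • x
  rw [map_mul, mul_comm, mul_smul]

lemma smulEnd_add (M : X.Modules) (a b : Γ(X, ⊤)) :
    smulEnd M (a + b) = smulEnd M a + smulEnd M b := by
  ext U x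
  simp [smulEnd_app, add_smul]

lemma smulEnd_one (M : X.Modules) :
    smulEnd M 1 = 𝟙 M := by
  ext U x
  simp [smulEnd_app]

lemma smulEnd_zero (M : X.Modules) :
    smulEnd M 0 = 0 := by
  ext U x
  simp [smulEnd_app]

/-- Scalar multiplication by global functions makes the category of `𝒪_X`-modules linear. -/
instance linearModules : Linear Γ(X, ⊤) X.Modules where
  homModule M N :=
    { smul a φ := smulEnd M a ≫ φ
      one_smul φ := by change smulEnd M 1 ≫ φ = φ; rw [smulEnd_one, Category.id_comp]
      mul_smul a b φ := by
        change smulEnd M (a * b) ≫ φ = smulEnd M a ≫ smulEnd M b ≫ φ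
        rw [smulEnd_mul, Category.assoc]
      smul_zero a := comp_zero
      smul_add a φ ψ := Preadditive.comp_add _ _ _ _ _ _
      add_smul a b φ := by
        change smulEnd M (a + b) ≫ φ = smulEnd M a ≫ φ + smulEnd M b ≫ φ
        rw [smulEnd_add, Preadditive.add_comp]
      zero_smul φ := by
        change smulEnd M 0 ≫ φ = 0
        rw [smulEnd_zero, zero_comp] }
  smul_comp M N P a φ ψ := Category.assoc _ _ _
  comp_smul M N P φ a ψ := by
    change φ ≫ smulEnd N a ≫ ψ = smulEnd M a ≫ φ ≫ ψ
    rw [← Category.assoc, ← smulEnd_comp, Category.assoc]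

lemma smul_hom_def {M N : X.Modules} (a : Γ(X, ⊤)) (φ : M ⟶ N) : a • φ = smulEnd M a ≫ φ := rfl

lemma pushforward_map_smulEnd (f : X ⟶ Y) (M : X.Modules) (a : Γ(Y, ⊤)) :
    (Scheme.Modules.pushforward f).map (smulEnd M (f.appTop a)) =
      smulEnd ((Scheme.Modules.pushforward f).obj M) a := by
  ext U x
  have : resTop (f ⁻¹ᵁ U) (f.appTop a) = f.app U (resTop U a) := by
    simp only [resTop, Scheme.Hom.appTop, ← CommRingCat.comp_apply, Scheme.Hom.naturality]
    rfl
  change resTop (f ⁻¹ᵁ U) (f.appTop a) • (show Γ(M, f ⁻¹ᵁ U) from x) =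
    f.app U (resTop U a) • (show Γ(M, f ⁻¹ᵁ U) from x)
  rw [this]

lemma pullback_map_smulEnd (f : X ⟶ Y) (M : Y.Modules) (a : Γ(Y, ⊤)) :
    (Scheme.Modules.pullback f).map (smulEnd M a) =
      smulEnd ((Scheme.Modules.pullback f).obj M) (f.appTop a) := by
  apply ((Scheme.Modules.pullbackPushforwardAdjunction f).homEquiv _ _).injective
  rw [Adjunction.homEquiv_unit, Adjunction.homEquiv_unit, pushforward_map_smulEnd]
  refine Eq.trans ?_ (smulEnd_comp a _)
  exact ((Scheme.Modules.pullbackPushforwardAdjunction f).unit.naturality (smulEnd M a)).symm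

lemma pullback_map_smul (f : X ⟶ Y) {M N : Y.Modules} (a : Γ(Y, ⊤)) (φ : M ⟶ N) :
    (Scheme.Modules.pullback f).map (a • φ) =
      f.appTop a • (Scheme.Modules.pullback f).map φ := by
  rw [smul_hom_def, Functor.map_comp, pullback_map_smulEnd, smul_hom_def]

/-- The structure sheaf as a module over itself. -/
abbrev unitModule (X : Scheme.{u}) : X.Modules := SheafOfModules.unit X.ringCatSheaf

lemma smulEnd_unitModule_injective {a : Γ(X, ⊤)} (h : smulEnd (unitModule X) a = 0) : a = 0 := by
  have := congr((Scheme.Modules.Hom.app $h ⊤) (show Γ(unitModule X, ⊤) from (1 : Γ(X, ⊤))))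
  rw [smulEnd_app] at this
  change resTop ⊤ a * 1 = 0 at this
  rw [mul_one] at this
  have h2 : resTop (⊤ : X.Opens) = RingHom.id _ := by
    ext x
    exact congr($(X.presheaf.map_id _) x)
  simpa [h2] using this

lemma smulEnd_pullback_unitModule_injective (f : X ⟶ Y) {a : Γ(X, ⊤)}
    (h : smulEnd ((Scheme.Modules.pullback f).obj (unitModule Y)) a = 0) : a = 0 := by
  let v : unitModule Y ⟶ (Scheme.Modules.pushforward f).obj (unitModule X) :=
    SheafOfModules.unitToPushforwardObjUnit f.toRingCatSheafHom
  let e := (Scheme.Modules.pullbackPushforwardAdjunction f).homEquiv (unitModule Y) (unitModule X)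
  have hc : e.symm v ≫ smulEnd _ a = 0 := by rw [← smulEnd_comp, h, zero_comp]
  have h2 : v ≫ (Scheme.Modules.pushforward f).map (smulEnd (unitModule X) a) = 0 := by
    rw [← Equiv.apply_symm_apply e v, ← Adjunction.homEquiv_naturality_right, hc,
      Adjunction.homEquiv_unit, Functor.map_zero, comp_zero]
  apply smulEnd_unitModule_injective
  ext U x
  have h3 : resTop ⊤ a * f.appTop 1 = 0 :=
    congr((Scheme.Modules.Hom.app $h2 ⊤) (show Γ(unitModule Y, ⊤) from (1 : Γ(Y, ⊤))))
  have h4 : resTop (⊤ : X.Opens) = RingHom.id _ := by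
    ext x
    exact congr($(X.presheaf.map_id _) x)
  rw [map_one, mul_one, h4] at h3
  have h5 : a = 0 := h3
  rw [h5, smulEnd_zero]

end Scalars

/-! ### Free modules -/

section Free

open SheafOfModules
variable {X : Scheme.{u}}

/-- The free `𝒪_X`-module with basis `I`. -/
abbrev freeModule (X : Scheme.{u}) (I : Type u) : X.Modules := SheafOfModules.free I

/-- The `i`-th basis vector of a free module. -/
def basisVec {I : Type u} (i : I) : unitModule X ⟶ freeModule X I := ιFree i

lemma freeModule_hom_ext {I : Type u} {M : X.Modules} {f g : freeModule X I ⟶ M}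
    (h : ∀ i, basisVec i ≫ f = basisVec i ≫ g) : f = g :=
  Cofan.IsColimit.hom_ext (isColimitFreeCofan I) _ _ h

/-- The map from a free module with given values on the basis. -/
def freeDesc {I : Type u} {M : X.Modules} (s : I → (unitModule X ⟶ M)) : freeModule X I ⟶ M :=
  Cofan.IsColimit.desc (isColimitFreeCofan I) s

@[simp]
lemma basisVec_freeDesc {I : Type u} {M : X.Modules} (s : I → (unitModule X ⟶ M)) (i : I) :
    basisVec i ≫ freeDesc s = s i :=
  Cofan.IsColimit.fac (isColimitFreeCofan I) s i

open Classical in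
/-- The `i`-th coordinate on a free module. -/
def coord {I : Type u} (i : I) : freeModule X I ⟶ unitModule X :=
  freeDesc fun j => if j = i then 𝟙 _ else 0

@[simp]
lemma basisVec_coord_self {I : Type u} (i : I) : basisVec (X := X) i ≫ coord i = 𝟙 _ := by
  simp [coord]

@[simp]
lemma basisVec_coord_self_assoc {I : Type u} (i : I) {N : X.Modules} (f : unitModule X ⟶ N) :
    basisVec i ≫ coord i ≫ f = f := by
  rw [← Category.assoc, basisVec_coord_self, Category.id_comp]

lemma basisVec_coord_ne {I : Type u} {i j : I} (h : i ≠ j) :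
    basisVec (X := X) i ≫ coord j = 0 := by
  simp [coord, h]

lemma basisVec_coord_ne_assoc {I : Type u} {i j : I} (h : i ≠ j) {N : X.Modules}
    (f : unitModule X ⟶ N) : basisVec i ≫ coord j ≫ f = 0 := by
  rw [← Category.assoc, basisVec_coord_ne h, zero_comp]

lemma sum_coord_basisVec {I : Type u} [Fintype I] :
    ∑ i : I, coord (X := X) i ≫ basisVec i = 𝟙 _ := by
  classical
  refine freeModule_hom_ext fun j => ?_
  rw [Preadditive.comp_sum, Finset.sum_eq_single j]
  · simp
  · intro i _ hij
    rw [basisVec_coord_ne_assoc hij.symm]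
  · simp

/-- The map of free modules induced by a map of index sets. -/
def reindex {I J : Type u} (f : J → I) : freeModule X J ⟶ freeModule X I :=
  freeDesc fun j => basisVec (f j)

@[simp]
lemma basisVec_reindex {I J : Type u} (f : J → I) (j : J) :
    basisVec (X := X) j ≫ reindex f = basisVec (f j) := by
  simp [reindex]

@[simp]
lemma basisVec_reindex_assoc {I J : Type u} (f : J → I) (j : J) {N : X.Modules}
    (g : freeModule X I ⟶ N) : basisVec j ≫ reindex f ≫ g = basisVec (f j) ≫ g := by
  rw [← Category.assoc, basisVec_reindex]

@[simp]
lemma reindex_comp {I J K : Type u} (f : J → I) (g : K → J) :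
    reindex (X := X) g ≫ reindex f = reindex (f ∘ g) :=
  freeModule_hom_ext fun i => by simp

lemma reindex_id {I : Type u} : reindex (X := X) (id : I → I) = 𝟙 _ :=
  freeModule_hom_ext fun i => by simp

lemma isIso_reindex {I J : Type u} (e : J ≃ I) : IsIso (reindex (X := X) e) :=
  ⟨reindex e.symm, by simp [reindex_id], by simp [reindex_id]⟩

open Classical in
/-- A retraction of `reindex f` for injective `f`: it forgets the coordinates outside the range. -/
def unreindex {I J : Type u} (f : J → I) : freeModule X I ⟶ freeModule X J :=
  freeDesc fun i => if h : ∃ j, f j = i then basisVec h.choose else 0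

lemma basisVec_unreindex {I J : Type u} {f : J → I} (hf : Function.Injective f) (j : J) :
    basisVec (X := X) (f j) ≫ unreindex f = basisVec j := by
  have h : ∃ j', f j' = f j := ⟨j, rfl⟩
  rw [unreindex, basisVec_freeDesc, dif_pos h, hf h.choose_spec]

lemma reindex_unreindex {I J : Type u} {f : J → I} (hf : Function.Injective f) :
    reindex (X := X) f ≫ unreindex f = 𝟙 _ :=
  freeModule_hom_ext fun i => by simp [basisVec_unreindex hf]

/-- If `f : J → I` is injective and misses exactly the index `i`, then the cokernel of
`𝒪^J ⟶ 𝒪^I` is `𝒪`, through the `i`-th coordinate. -/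
def cokernelReindexIso {I J : Type u} (f : J → I) (i : I) (hi : ∀ j, f j ≠ i)
    (hi' : ∀ i', i' ≠ i → ∃ j, f j = i') :
    cokernel (reindex (X := X) f) ≅ unitModule X where
  hom := cokernel.desc _ (coord i) (freeModule_hom_ext fun j => by
    rw [basisVec_reindex_assoc, basisVec_coord_ne (hi j), comp_zero])
  inv := basisVec i ≫ cokernel.π _
  hom_inv_id := by
    rw [← cancel_epi (cokernel.π _), cokernel.π_desc_assoc]
    refine freeModule_hom_ext fun i' => ?_
    by_cases h : i' = i
    · subst h; simp
    · obtain ⟨j, rfl⟩ := hi' i' h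
      rw [basisVec_coord_ne_assoc h, Category.comp_id, ← basisVec_reindex_assoc,
        cokernel.condition, comp_zero]
  inv_hom_id := by simp

/-- `𝒪` is the free module on a one-element type. -/
def unitIsoFree (I : Type u) [Unique I] : unitModule X ≅ freeModule X I where
  hom := basisVec default
  inv := coord default
  hom_inv_id := by simp
  inv_hom_id := by simpa using sum_coord_basisVec (X := X) (I := I)

lemma isZero_freeModule (I : Type u) [IsEmpty I] : IsZero (freeModule X I) := by
  rw [IsZero.iff_id_eq_zero]
  exact freeModule_hom_ext fun i => isEmptyElim i

/-- The restriction of a free module to an open subscheme is free. -/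
def freeModuleRestrictIso (U : X.Opens) (I : Type u) :
    (freeModule X I).restrict U.ι ≅ freeModule U I :=
  letI F : SheafOfModules X.ringCatSheaf ⥤ SheafOfModules (U : Scheme.{u}).ringCatSheaf :=
    Scheme.Modules.restrictFunctor U.ι
  haveI : F.IsLeftAdjoint :=
    inferInstanceAs (Scheme.Modules.restrictFunctor U.ι).IsLeftAdjoint
  (mapFreeIso F I (Scheme.Modules.restrictUnitIso U.ι).symm).symm

lemma isVectorBundle_freeModule (r : ℕ) : IsVectorBundle (freeModule X (ULift.{u} (Fin r))) :=
  fun _ => ⟨⊤, r, trivial, ⟨freeModuleRestrictIso _ _⟩⟩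

lemma isLineBundle_of_iso {L : X.Modules} (e : L ≅ unitModule X) : IsLineBundle L :=
  fun _ => ⟨⊤, trivial, ⟨(Scheme.Modules.restrictFunctor (⊤ : X.Opens).ι).mapIso
    (e ≪≫ unitIsoFree (ULift.{u} (Fin 1))) ≪≫ freeModuleRestrictIso _ _⟩⟩

end Free

/-! ### Matrices acting on free modules and their flags -/

section MatrixAction

variable {S : Scheme.{u}} {n : ℕ}

/-- The elementary endomorphism of `𝒪_S^n` which sends the `j`-th basis vector to the `i`-th. -/
def elemEnd (S : Scheme.{u}) (i j : Fin n) :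
    freeModule S (ULift.{u} (Fin n)) ⟶ freeModule S (ULift.{u} (Fin n)) :=
  coord ⟨j⟩ ≫ basisVec ⟨i⟩

lemma basisVec_elemEnd (i j k : Fin n) : basisVec (ULift.up k) ≫ elemEnd S i j =
    if k = j then basisVec (ULift.up i) else 0 := by
  split_ifs with h
  · subst h; simp [elemEnd]
  · rw [elemEnd, basisVec_coord_ne_assoc (by simpa using h)]

lemma elemEnd_comp (i j k l : Fin n) : elemEnd S i j ≫ elemEnd S k l =
    if i = l then elemEnd S k j else 0 := by
  rw [elemEnd, Category.assoc, basisVec_elemEnd]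
  split_ifs <;> simp [elemEnd]

/-- The endomorphism of `𝒪_T^n`, the pullback to `T` of the free module of rank `n` on `S`, which is
given by a matrix of global functions on `T`. The matrix acts on column vectors. -/
def matEnd (T : Over S) (A : Matrix (Fin n) (Fin n) Γ(T.left, ⊤)) :
    pull (freeModule S (ULift.{u} (Fin n))) T ⟶ pull (freeModule S (ULift.{u} (Fin n))) T :=
  ∑ i, ∑ j, A i j • pullMap (elemEnd S i j) T

/-- The matrix entries can be read off from the endomorphism. -/
lemma basisVec_matEnd_coord (T : Over S) (A : Matrix (Fin n) (Fin n) Γ(T.left, ⊤)) (k l : Fin n) :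
    pullMap (basisVec (.up l)) T ≫ matEnd T A ≫ pullMap (coord (.up k)) T =
      smulEnd _ (A k l) := by
  have : ∀ i j, pullMap (basisVec (.up l)) T ≫ pullMap (elemEnd S i j) T ≫
      pullMap (coord (.up k)) T = if i = k then if j = l then 𝟙 _ else 0 else 0 := by
    intro i j
    rw [← Functor.map_comp, ← Functor.map_comp, ← Category.assoc, basisVec_elemEnd]
    by_cases h1 : i = k <;> by_cases h2 : j = l
    · subst h1 h2; simp
    · simp [h1, h2, Ne.symm h2]
    · rw [if_pos h2.symm, if_neg h1,
        basisVec_coord_ne (by simpa using h1), Functor.map_zero]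
    · simp [h1, Ne.symm h2]
  simp only [matEnd, Preadditive.sum_comp, Preadditive.comp_sum, Linear.smul_comp,
    Linear.comp_smul, this]
  rw [Finset.sum_eq_single k, Finset.sum_eq_single l]
  · simp [smul_hom_def]
  all_goals simp +contextual

lemma matEnd_injective (T : Over S) : Function.Injective (matEnd (n := n) T) := by
  intro A B h
  ext i j
  have h1 := basisVec_matEnd_coord T A i j
  rw [h, basisVec_matEnd_coord T B i j] at h1
  rw [← sub_eq_zero]
  apply smulEnd_pullback_unitModule_injective T.hom
  rw [sub_eq_add_neg, smulEnd_add]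
  erw [← h1]
  rw [← smulEnd_add, add_neg_cancel, smulEnd_zero]

lemma matEnd_one (T : Over S) : matEnd (n := n) T 1 = 𝟙 _ := by
  simp only [matEnd, Matrix.one_apply, ite_smul, one_smul, zero_smul, Finset.sum_ite_eq,
    Finset.mem_univ, if_true]
  rw [← Functor.map_sum, ← CategoryTheory.Functor.map_id, ← sum_coord_basisVec]
  congr 1
  exact (Equiv.ulift.{u}.symm.sum_comp (fun j => coord (X := S) j ≫ basisVec j))

lemma matEnd_mul (T : Over S) (A B : Matrix (Fin n) (Fin n) Γ(T.left, ⊤)) :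
    matEnd T (A * B) = matEnd T B ≫ matEnd T A := by
  have : ∀ i j k l, pullMap (elemEnd S i j) T ≫ pullMap (elemEnd S k l) T =
      if i = l then pullMap (elemEnd (n := n) S k j) T else 0 := by
    intro i j k l
    rw [← Functor.map_comp, elemEnd_comp]
    split_ifs
    · rfl
    · rw [Functor.map_zero]
  simp only [matEnd, Preadditive.sum_comp, Preadditive.comp_sum, Linear.smul_comp,
    Linear.comp_smul, this, Matrix.mul_apply, Finset.sum_smul, smul_ite, smul_zero, mul_smul]
  refine Finset.sum_congr rfl fun x _ => ?_
  rw [Finset.sum_comm]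
  refine Finset.sum_congr rfl fun y _ => ?_
  rw [← Finset.smul_sum]
  congr 1
  refine Eq.symm (Eq.trans (Finset.sum_eq_single y (fun z _ hz => by simp [hz]) (by simp)) ?_)
  simp

lemma pullIso_naturality {E F : S.Modules} (φ : E ⟶ F) {T' T : Over S} (h : T' ⟶ T) :
    (Scheme.Modules.pullback h.left).map (pullMap φ T) ≫ (pullIso F h).hom =
      (pullIso E h).hom ≫ pullMap φ T' := by
  have h1 := (Scheme.Modules.pullbackComp h.left T.hom).hom.naturality φ
  have h2 := (Scheme.Modules.pullbackCongr (Over.w h)).hom.naturality φ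
  simp only [pullIso, Iso.trans_hom, Iso.app_hom, Category.assoc]
  rw [← h2, ← Category.assoc, ← Category.assoc]
  congr 1

lemma pullback_map_matEnd {T' T : Over S} (h : T' ⟶ T)
    (A : Matrix (Fin n) (Fin n) Γ(T.left, ⊤)) :
    (Scheme.Modules.pullback h.left).map (matEnd T A) ≫ (pullIso _ h).hom =
      (pullIso _ h).hom ≫ matEnd T' (A.map h.left.appTop) := by
  simp only [matEnd, Functor.map_sum, Preadditive.sum_comp, Preadditive.comp_sum,
    pullIso_naturality, pullback_map_smul, Linear.smul_comp, Linear.comp_smul, Matrix.map_apply]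

/-- The inclusion of the span of the first `m` basis vectors of `𝒪^n`. -/
abbrev firstVecs (S : Scheme.{u}) {m n : ℕ} (h : m ≤ n) :
    freeModule S (ULift.{u} (Fin m)) ⟶ freeModule S (ULift.{u} (Fin n)) :=
  reindex (ULift.map (Fin.castLE h))

lemma ulift_map_castLE_injective {m n : ℕ} (h : m ≤ n) :
    Function.Injective (ULift.map (Fin.castLE h) : ULift.{u} (Fin m) → ULift.{u} (Fin n)) :=
  ULift.map_injective.2 (Fin.castLE_injective h)

/-- An upper triangular matrix preserves the span of the first `m` basis vectors. -/
lemma firstVecs_matEnd {m : ℕ} (hm : m ≤ n) (T : Over S)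
    (A : Matrix (Fin n) (Fin n) Γ(T.left, ⊤)) (hA : ∀ i j, j < i → A i j = 0) :
    (pullMap (firstVecs S hm) T ≫ matEnd T A ≫ pullMap (unreindex (ULift.map (Fin.castLE hm))) T) ≫
      pullMap (firstVecs S hm) T = pullMap (firstVecs S hm) T ≫ matEnd T A := by
  simp only [matEnd, Preadditive.sum_comp, Preadditive.comp_sum, Linear.smul_comp,
    Linear.comp_smul, Category.assoc]
  refine Finset.sum_congr rfl fun p _ => Finset.sum_congr rfl fun q _ => ?_
  rcases lt_or_ge q p with hqp | hqp
  · rw [hA p q hqp, zero_smul, zero_smul]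
  congr 1
  rw [← Functor.map_comp, ← Functor.map_comp, ← Functor.map_comp, ← Functor.map_comp]
  congr 1
  refine freeModule_hom_ext fun k => ?_
  rw [basisVec_reindex_assoc, basisVec_reindex_assoc, ← Category.assoc]
  change (basisVec (ULift.up (Fin.castLE hm k.down)) ≫ elemEnd S p q) ≫ _ =
    basisVec (ULift.up (Fin.castLE hm k.down)) ≫ elemEnd S p q
  rw [basisVec_elemEnd]
  split_ifs with hk
  · have hp : (p : ℕ) < m := lt_of_le_of_lt hqp (by rw [← hk]; exact k.down.2)
    have := basisVec_unreindex (X := S) (ulift_map_castLE_injective hm) ⟨⟨p, hp⟩⟩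
    have h2 := basisVec_reindex (X := S) (ULift.map (Fin.castLE hm)) ⟨⟨p, hp⟩⟩
    change basisVec (ULift.up p) ≫ _ = _ at this
    change _ = basisVec (ULift.up p) at h2
    rw [← Category.assoc, this, h2]
  · rw [zero_comp]

/-- A group scheme with a faithful representation by upper triangular matrices is trigonalizable:
the flag consists of the spans of the first basis vectors. -/
theorem isTrigonalizable_of_upperTriangular (G : Over S) [GrpObj G]
    (M : ∀ T : Over S, (T ⟶ G) →* Matrix (Fin n) (Fin n) Γ(T.left, ⊤))
    (nat : ∀ {T' T : Over S} (h : T' ⟶ T) (g : T ⟶ G),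
      M T' (h ≫ g) = (M T g).map h.left.appTop)
    (inj : ∀ T, Function.Injective (M T))
    (tri : ∀ T g i j, j < i → M T g i j = 0) : IsTrigonalizable G := by
  let ρ : EquivariantStructure G (freeModule S (ULift.{u} (Fin n))) :=
    { act T :=
        { toFun g := ⟨matEnd T (M T g), matEnd T (M T g⁻¹),
            by rw [← matEnd_mul, ← map_mul, inv_mul_cancel, map_one, matEnd_one],
            by rw [← matEnd_mul, ← map_mul, mul_inv_cancel, map_one, matEnd_one]⟩
          map_one' := by
            ext1
            change matEnd T (M T 1) = _
            rw [map_one, matEnd_one]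
            rfl
          map_mul' g h := by
            ext1
            change matEnd T (M T (g * h)) = matEnd T (M T h) ≫ matEnd T (M T g)
            rw [map_mul, matEnd_mul] }
      act_comp h g := by
        change _ = _ ≫ matEnd _ (M _ (h ≫ g))
        rw [nat]
        exact pullback_map_matEnd h (M _ g) }
  refine ⟨_, ρ, n, isVectorBundle_freeModule n, fun T g h hgh => ?_, ⟨?_⟩⟩
  · exact inj T (matEnd_injective T congr(($hgh).hom))
  · exact
    { F i := freeModule S (ULift.{u} (Fin (n - i)))
      toE i := firstVecs S (Nat.sub_le _ _)
      incl i := firstVecs S (by simp; omega)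
      mono_toE i := (SplitMono.mk _ (reindex_unreindex (ulift_map_castLE_injective _))).mono
      incl_toE i := by
        rw [reindex_comp]
        rfl
      first_eq := isIso_reindex (Equiv.refl _)
      last_eq := by
        have : IsEmpty (ULift.{u} (Fin (n - Fin.last n))) := by
          simp only [Fin.val_last, Nat.sub_self]; infer_instance
        exact isZero_freeModule _
      stable i T g := ⟨_, firstVecs_matEnd _ T _ (tri T g)⟩
      quotient_isLineBundle i := by
        refine isLineBundle_of_iso (cokernelReindexIso _ ⟨⟨n - i - 1, ?_⟩⟩ ?_ ?_)
        · have := i.2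
          simp only [Fin.val_castSucc]
          omega
        · rintro ⟨j⟩ h
          have := congr((ULift.down $h : ℕ))
          have h2 := j.2
          simp only [Fin.val_succ] at h2
          change (j : ℕ) = n - i - 1 at this
          omega
        · rintro ⟨j⟩ h
          have h2 := j.2
          have h3 : (j : ℕ) ≠ n - i - 1 := fun h3 => h (by ext; exact h3)
          simp only [Fin.val_castSucc] at h2
          refine ⟨⟨⟨j, ?_⟩⟩, rfl⟩
          simp only [Fin.val_succ]
          omega }

end MatrixAction

/-! ### Morphisms to affine schemes -/

section Sharp

/-- The ring homomorphism `A → Γ(T, 𝒪_T)` corresponding to a morphism `T ⟶ Spec A`. -/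
def sharp {T : Scheme.{u}} {A : CommRingCat.{u}} (f : T ⟶ Spec A) : A →+* Γ(T, ⊤) :=
  ((Scheme.ΓSpecIso A).inv ≫ f.appTop).hom

lemma sharp_comp_specMap {T : Scheme.{u}} {A B : CommRingCat.{u}} (f : T ⟶ Spec B) (φ : A ⟶ B) :
    sharp (f ≫ Spec.map φ) = (sharp f).comp φ.hom := by
  rw [sharp, sharp, ← CommRingCat.hom_comp, Scheme.Hom.comp_appTop, ← Category.assoc,
    ← Category.assoc, Scheme.ΓSpecIso_inv_naturality]

lemma sharp_comp {T' T : Scheme.{u}} {A : CommRingCat.{u}} (h : T' ⟶ T) (f : T ⟶ Spec A) :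
    sharp (h ≫ f) = h.appTop.hom.comp (sharp f) := by
  rw [sharp, sharp, ← CommRingCat.hom_comp, Scheme.Hom.comp_appTop, Category.assoc]

lemma sharp_injective {T : Scheme.{u}} {A : CommRingCat.{u}} {f g : T ⟶ Spec A}
    (h : sharp f = sharp g) : f = g := by
  refine ext_of_isAffine ?_
  rw [← cancel_epi (Scheme.ΓSpecIso A).inv]
  exact CommRingCat.hom_ext h

lemma sharp_id (A : CommRingCat.{u}) : sharp (𝟙 (Spec A)) = (Scheme.ΓSpecIso A).inv.hom := by
  simp [sharp]

lemma sharp_specMap {A B : CommRingCat.{u}} (φ : A ⟶ B) :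
    sharp (Spec.map φ) = (Scheme.ΓSpecIso B).inv.hom.comp φ.hom := by
  rw [← Category.id_comp (Spec.map φ), sharp_comp_specMap, sharp_id]

lemma sharp_specMap_apply {A B : CommRingCat.{u}} (φ : A ⟶ B) (x : A) :
    sharp (Spec.map φ) x = sharp (𝟙 (Spec B)) (φ x) := by
  rw [sharp_specMap, sharp_id]
  rfl

lemma sharp_id_injective (A : CommRingCat.{u}) : Function.Injective (sharp (𝟙 (Spec A))) := by
  rw [sharp_id]
  exact (Scheme.ΓSpecIso A).symm.commRingCatIsoToRingEquiv.injective

end Sharp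

/-! ### Points of the group scheme of a Hopf algebra -/

section Hopf

variable {k : Type u} [Field k]
open TensorProduct

lemma exists_hopfAlgebra (G : Over (Spec (CommRingCat.of k))) [GrpObj G] [IsAffineHom G.hom] :
    ∃ (H : Type u) (_ : CommRing H) (_ : HopfAlgebra k H)
      (e : (Spec (CommRingCat.of H)).asOver (Spec (CommRingCat.of k)) ≅ G), IsMonHom e.hom := by
  have : IsAffine G.left := isAffine_of_isAffineHom G.hom
  obtain ⟨H, ⟨e⟩⟩ := (essImage_hopfSpec (R := CommRingCat.of k) (G := ⟨G⟩)).2 this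
  refine ⟨H.unop, inferInstance, inferInstance, (Grp.forget _).mapIso e, ?_⟩
  exact e.hom.hom.isMonHom_hom

/-- Two morphisms to affine schemes over `Spec k` induce a map on the tensor product. -/
lemma exists_tensor_hom {A B : Type u} [CommRing A] [CommRing B] [Algebra k A] [Algebra k B]
    {T : Scheme.{u}} (f : T ⟶ Spec (.of A)) (g : T ⟶ Spec (.of B))
    (h : f ≫ Spec.map (CommRingCat.ofHom (algebraMap k A)) =
      g ≫ Spec.map (CommRingCat.ofHom (algebraMap k B))) :
    ∃ w : A ⊗[k] B →+* Γ(T, ⊤), ∀ a b, w (a ⊗ₜ b) = sharp f a * sharp g b := by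
  have h1 := congr(sharp $h)
  rw [sharp_comp_specMap, sharp_comp_specMap] at h1
  let : Algebra k Γ(T, ⊤) := ((sharp f).comp (algebraMap k A)).toAlgebra
  let f' : A →ₐ[k] Γ(T, ⊤) := ⟨sharp f, fun _ => rfl⟩
  let g' : B →ₐ[k] Γ(T, ⊤) := ⟨sharp g, fun r => congr($(h1.symm) r)⟩
  exact ⟨(Algebra.TensorProduct.productMap f' g').toRingHom, fun a b => by simp [f', g']⟩

variable {H : Type u} [CommRing H] [HopfAlgebra k H]

/-- The affine group scheme of a Hopf algebra. -/
abbrev specHopf (k H : Type u) [Field k] [CommRing H] [HopfAlgebra k H] :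
    Over (Spec (CommRingCat.of k)) :=
  (Spec (CommRingCat.of H)).asOver (Spec (CommRingCat.of k))

lemma sharp_mul {T : Over (Spec (CommRingCat.of k))} (g h : T ⟶ specHopf k H) (x : H)
    {s : Type*} [Fintype s] (a b : s → H)
    (hx : Coalgebra.comul (R := k) x = ∑ l, a l ⊗ₜ[k] b l) :
    sharp (g * h).left x = ∑ l, sharp g.left (a l) * sharp h.left (b l) := by
  let m : T.left ⟶ Spec (.of (H ⊗[k] H)) := (lift g h).left ≫ (pullbackSpecIso k H H).hom
  have h1 : (g * h).left =
      m ≫ Spec.map (CommRingCat.ofHom (Bialgebra.comulAlgHom k H).toRingHom) := by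
    rw [Hom.mul_def, Over.comp_left, mul_spec_asOver_spec_left]
    exact (Category.assoc _ _ _).symm
  have hl : m ≫ Spec.map (CommRingCat.ofHom Algebra.TensorProduct.includeLeftRingHom) = g.left := by
    refine (Category.assoc _ _ _).trans ?_
    refine Eq.trans ?_ congr(($(lift_fst g h)).left)
    exact congr((lift g h).left ≫ $(pullbackSpecIso_hom_fst k H H))
  have hr : m ≫ Spec.map (CommRingCat.ofHom
      (Algebra.TensorProduct.includeRight : H →ₐ[k] H ⊗[k] H).toRingHom) = h.left := by
    refine (Category.assoc _ _ _).trans ?_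
    refine Eq.trans ?_ congr(($(lift_snd g h)).left)
    exact congr((lift g h).left ≫ $(pullbackSpecIso_hom_snd k H H))
  rw [h1, sharp_comp_specMap, ← hl, ← hr, sharp_comp_specMap, sharp_comp_specMap]
  change sharp m (Coalgebra.comul (R := k) x) =
    ∑ l, sharp m (a l ⊗ₜ[k] 1) * sharp m (1 ⊗ₜ[k] b l)
  rw [hx, map_sum]
  simp [← map_mul]

lemma sharp_one (T : Over (Spec (CommRingCat.of k))) (x : H) :
    sharp (1 : T ⟶ specHopf k H).left x = sharp T.hom (Coalgebra.counit (R := k) x) := by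
  have : (1 : T ⟶ specHopf k H).left =
      T.hom ≫ Spec.map (CommRingCat.ofHom (Bialgebra.counitAlgHom k H).toRingHom) := by
    rw [Hom.one_def, Over.comp_left, one_spec_asOver_spec_left]
    rfl
  rw [this, sharp_comp_specMap]
  rfl

variable {n : ℕ}

/-- The representation of the group scheme of `H` given by a multiplicative matrix. -/
def pointMatrix (a : Matrix (Fin n) (Fin n) H)
    (ha : ∀ i j, Coalgebra.comul (R := k) (a i j) = ∑ l, a i l ⊗ₜ[k] a l j)
    (ha' : ∀ i j, Coalgebra.counit (R := k) (a i j) = (1 : Matrix (Fin n) (Fin n) k) i j)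
    (T : Over (Spec (CommRingCat.of k))) :
    (T ⟶ specHopf k H) →* Matrix (Fin n) (Fin n) Γ(T.left, ⊤) where
  toFun g := a.map (sharp g.left)
  map_one' := by
    ext i j
    rw [Matrix.map_apply]
    erw [sharp_one T (a i j)]
    rw [ha', Matrix.one_apply, Matrix.one_apply]
    split_ifs
    · exact map_one _
    · exact map_zero _
  map_mul' g h := by
    ext i j
    rw [Matrix.mul_apply]
    exact sharp_mul g h _ _ _ (ha i j)

lemma pointMatrix_injective (a : Matrix (Fin n) (Fin n) H)
    (ha : ∀ i j, Coalgebra.comul (R := k) (a i j) = ∑ l, a i l ⊗ₜ[k] a l j)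
    (ha' : ∀ i j, Coalgebra.counit (R := k) (a i j) = (1 : Matrix (Fin n) (Fin n) k) i j)
    (hgen : Algebra.adjoin k (Set.range fun p : Fin n × Fin n => a p.1 p.2) = ⊤)
    (T : Over (Spec (CommRingCat.of k))) : Function.Injective (pointMatrix a ha ha' T) := by
  intro g h hgh
  ext1
  apply sharp_injective
  ext x
  have hx : x ∈ Algebra.adjoin k (Set.range fun p : Fin n × Fin n => a p.1 p.2) :=
    hgen ▸ Algebra.mem_top
  have hw : ∀ g : T ⟶ specHopf k H, ∀ c : k, sharp g.left (algebraMap k H c) = sharp T.hom c := by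
    intro g c
    have := congr(sharp $(Over.w g) c)
    erw [sharp_comp_specMap] at this
    exact this
  induction hx using Algebra.adjoin_induction with
  | mem x hx =>
    obtain ⟨⟨i, j⟩, rfl⟩ := hx
    exact congr($hgh i j)
  | algebraMap c => exact (hw g c).trans (hw h c).symm
  | add x y _ _ hx hy => exact (map_add _ _ _).trans ((congr($hx + $hy)).trans (map_add _ _ _).symm)
  | mul x y _ _ hx hy => exact (map_mul _ _ _).trans ((congr($hx * $hy)).trans (map_mul _ _ _).symm)

end Hopf

/-! ### Points of a base change -/

section BaseChange

/-- Points of the base change `f^* G` with values in an `S'`-scheme `T` are the points of `G` with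
values in `T`, considered as an `S`-scheme. -/
def pointsPullback {S S' : Scheme.{u}} (f : S' ⟶ S) (G : Over S) [GrpObj G] (T : Over S') :
    (T ⟶ (Over.pullback f).obj G) ≃* ((Over.map f).obj T ⟶ G) :=
  MulEquiv.symm
    { (Over.mapPullbackAdj f).homEquiv T G with
      map_mul' g h := by
        change (Over.mapPullbackAdj f).homEquiv T G (g * h) =
          (Over.mapPullbackAdj f).homEquiv T G g * (Over.mapPullbackAdj f).homEquiv T G h
        rw [Adjunction.homEquiv_unit, Adjunction.homEquiv_unit, Adjunction.homEquiv_unit,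
          Functor.map_mul, MonObj.comp_mul] }

lemma pointsPullback_comp {S S' : Scheme.{u}} (f : S' ⟶ S) (G : Over S) [GrpObj G] {T' T : Over S'}
    (h : T' ⟶ T) (g : T ⟶ (Over.pullback f).obj G) :
    pointsPullback f G T' (h ≫ g) = (Over.map f).map h ≫ pointsPullback f G T g :=
  (Over.mapPullbackAdj f).homEquiv_naturality_left_symm h g

end BaseChange

/-! ### Conjugates of a representation over an extension ring -/

section ConjugateRep

open TensorProduct

variable {k : Type u} [Field k] {H : Type u} [CommRing H] [HopfAlgebra k H]
  {G : Over (Spec (CommRingCat.of k))} [GrpObj G] (e : specHopf k H ≅ G) [IsMonHom e.hom]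
  {n : ℕ} (a : Matrix (Fin n) (Fin n) H)
  (ha : ∀ i j, Coalgebra.comul (R := k) (a i j) = ∑ l, a i l ⊗ₜ[k] a l j)
  (ha' : ∀ i j, Coalgebra.counit (R := k) (a i j) = (1 : Matrix (Fin n) (Fin n) k) i j)
  (R : Type u) [CommRing R] [Algebra k R]

/-- The morphism `Spec R ⟶ Spec k` for a `k`-algebra `R`. -/
abbrev baseMap (k R : Type u) [Field k] [CommRing R] [Algebra k R] :
    Spec (CommRingCat.of R) ⟶ Spec (CommRingCat.of k) :=
  Spec.map (CommRingCat.ofHom (algebraMap k R))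

/-- The point of the affine group scheme of `H` corresponding to a point of the base change of an
isomorphic group scheme `G`. -/
def hopfPoint (T : Over (Spec (CommRingCat.of R))) :
    (T ⟶ (Over.pullback (baseMap k R)).obj G) ≃* ((Over.map (baseMap k R)).obj T ⟶ specHopf k H) :=
  (pointsPullback (baseMap k R) G T).trans (Hom.mulEquivCongrRight e _).symm

lemma hopfPoint_comp {T' T : Over (Spec (CommRingCat.of R))} (h : T' ⟶ T)
    (g : T ⟶ (Over.pullback (baseMap k R)).obj G) :
    (hopfPoint e R T' (h ≫ g)).left = h.left ≫ (hopfPoint e R T g).left := by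
  have : hopfPoint e R T' (h ≫ g) = (Over.map (baseMap k R)).map h ≫ hopfPoint e R T g := by
    change pointsPullback _ _ _ _ ≫ e.inv = _ ≫ pointsPullback _ _ _ _ ≫ e.inv
    rw [pointsPullback_comp, Category.assoc]
  rw [this]
  rfl

/-- The ring homomorphism `H → Γ(T, 𝒪_T)` corresponding to a `T`-valued point of the base change
of `G` to `R`. -/
def pointHom (T : Over (Spec (CommRingCat.of R))) (g : T ⟶ (Over.pullback (baseMap k R)).obj G) :
    H →+* Γ(T.left, ⊤) :=
  sharp (T := T.left) (A := .of H) (hopfPoint e R T g).left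

lemma pointHom_comp {T' T : Over (Spec (CommRingCat.of R))} (h : T' ⟶ T)
    (g : T ⟶ (Over.pullback (baseMap k R)).obj G) :
    pointHom e R T' (h ≫ g) = h.left.appTop.hom.comp (pointHom e R T g) := by
  rw [pointHom, hopfPoint_comp]
  exact sharp_comp _ _

/-- The representation of the base change of `G` to `R` given by a multiplicative matrix. -/
def baseRep (T : Over (Spec (CommRingCat.of R))) :
    (T ⟶ (Over.pullback (baseMap k R)).obj G) →* Matrix (Fin n) (Fin n) Γ(T.left, ⊤) :=
  (pointMatrix a ha ha' ((Over.map (baseMap k R)).obj T)).comp (hopfPoint e R T).toMonoidHom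

lemma baseRep_apply (T : Over (Spec (CommRingCat.of R)))
    (g : T ⟶ (Over.pullback (baseMap k R)).obj G) :
    baseRep e a ha ha' R T g = a.map (pointHom e R T g) := rfl

lemma baseRep_comp {T' T : Over (Spec (CommRingCat.of R))} (h : T' ⟶ T)
    (g : T ⟶ (Over.pullback (baseMap k R)).obj G) :
    baseRep e a ha ha' R T' (h ≫ g) = (baseRep e a ha ha' R T g).map h.left.appTop := by
  rw [baseRep_apply, baseRep_apply, pointHom_comp, Matrix.map_map]
  rfl

lemma baseRep_injective
    (hgen : Algebra.adjoin k (Set.range fun p : Fin n × Fin n => a p.1 p.2) = ⊤)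
    (T : Over (Spec (CommRingCat.of R))) : Function.Injective (baseRep e a ha ha' R T) :=
  (pointMatrix_injective a ha ha' hgen _).comp (hopfPoint e R T).injective

/-- The entries `∑ Q i s * P t j ⊗ a s t` of the matrix `Q a P` over `R ⊗ H`. -/
def conjEntry {R : Type u} [CommRing R] [Algebra k R] (P Q : Matrix (Fin n) (Fin n) R)
    (i j : Fin n) : R ⊗[k] H :=
  ∑ s, ∑ t, (Q i s * P t j) ⊗ₜ a s t

variable {R} (P Q : Matrix (Fin n) (Fin n) R)

/-- The representation of the base change of `G` to `R` given by the matrix `Q a P`, for mutually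
inverse matrices `P` and `Q` over `R`. -/
def conjRep (hPQ : P * Q = 1) (T : Over (Spec (CommRingCat.of R))) :
    (T ⟶ (Over.pullback (baseMap k R)).obj G) →* Matrix (Fin n) (Fin n) Γ(T.left, ⊤) where
  toFun g := Q.map (sharp T.hom) * baseRep e a ha ha' R T g * P.map (sharp T.hom)
  map_one' := by
    rw [map_one, mul_one]
    exact (Matrix.map_mul ..).symm.trans
      ((congr(($(mul_eq_one_comm.1 hPQ)).map (sharp T.hom))).trans
        (Matrix.map_one _ (map_zero _) (map_one _)))
  map_mul' g h := by
    have h1 : P.map (sharp T.hom) * Q.map (sharp T.hom) = 1 :=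
      (Matrix.map_mul ..).symm.trans ((congr(($hPQ).map (sharp T.hom))).trans
        (Matrix.map_one _ (map_zero _) (map_one _)))
    rw [map_mul]
    calc _ = Q.map (sharp T.hom) * baseRep e a ha ha' R T g *
          (P.map (sharp T.hom) * Q.map (sharp T.hom)) * baseRep e a ha ha' R T h *
            P.map (sharp T.hom) := by rw [h1]; simp only [mul_assoc, one_mul]
      _ = _ := by simp only [mul_assoc]

lemma conjRep_apply (hPQ : P * Q = 1) (T : Over (Spec (CommRingCat.of R)))
    (g : T ⟶ (Over.pullback (baseMap k R)).obj G) :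
    conjRep e a ha ha' P Q hPQ T g =
      Q.map (sharp T.hom) * a.map (pointHom e R T g) * P.map (sharp T.hom) := rfl

lemma conjRep_comp (hPQ : P * Q = 1)
    {T' T : Over (Spec (CommRingCat.of R))} (h : T' ⟶ T)
    (g : T ⟶ (Over.pullback (baseMap k R)).obj G) :
    conjRep e a ha ha' P Q hPQ T' (h ≫ g) =
      (conjRep e a ha ha' P Q hPQ T g).map h.left.appTop := by
  have hT : (sharp T'.hom : R →+* _) = h.left.appTop.hom.comp (sharp T.hom) := by
    rw [← sharp_comp, Over.w]
  rw [conjRep_apply, conjRep_apply, pointHom_comp, hT]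
  refine Eq.trans ?_ (Matrix.map_mul (f := h.left.appTop.hom)).symm
  rw [Matrix.map_mul, Matrix.map_map, Matrix.map_map, Matrix.map_map]
  rfl

lemma conjRep_injective (hPQ : P * Q = 1)
    (hgen : Algebra.adjoin k (Set.range fun p : Fin n × Fin n => a p.1 p.2) = ⊤)
    (T : Over (Spec (CommRingCat.of R))) : Function.Injective (conjRep e a ha ha' P Q hPQ T) := by
  intro g h hgh
  have h1 : P.map (sharp T.hom) * Q.map (sharp T.hom) = 1 :=
    (Matrix.map_mul ..).symm.trans ((congr(($hPQ).map (sharp T.hom))).trans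
      (Matrix.map_one _ (map_zero _) (map_one _)))
  apply baseRep_injective e a ha ha' R hgen T
  have key : ∀ g, baseRep e a ha ha' R T g =
      P.map (sharp T.hom) * conjRep e a ha ha' P Q hPQ T g * Q.map (sharp T.hom) := by
    intro g
    change _ = P.map (sharp T.hom) * (Q.map (sharp T.hom) * baseRep e a ha ha' R T g *
      P.map (sharp T.hom)) * Q.map (sharp T.hom)
    calc _ = (P.map (sharp T.hom) * Q.map (sharp T.hom)) * baseRep e a ha ha' R T g *
          (P.map (sharp T.hom) * Q.map (sharp T.hom)) := by rw [h1, one_mul, mul_one]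
      _ = _ := by simp only [mul_assoc]
  rw [key g, key h, hgh]

/-- The entries of the representation `Q a P` on a `T`-valued point are the images of the elements
`conjEntry a P Q i j` under the ring homomorphism `R ⊗ H → Γ(T, 𝒪_T)` defined by the point. -/
lemma exists_map_conjEntry (hPQ : P * Q = 1)
    (T : Over (Spec (CommRingCat.of R))) (g : T ⟶ (Over.pullback (baseMap k R)).obj G) :
    ∃ w : R ⊗[k] H →+* Γ(T.left, ⊤),
      (∀ r x, w (r ⊗ₜ x) = sharp T.hom r * pointHom e R T g x) ∧
      ∀ i j, w (conjEntry a P Q i j) = conjRep e a ha ha' P Q hPQ T g i j := by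
  obtain ⟨w, hw⟩ := exists_tensor_hom (k := k) (A := R) (B := H) T.hom (hopfPoint e R T g).left
    (Over.w (hopfPoint e R T g)).symm
  have hw' : ∀ r x, w (r ⊗ₜ x) = sharp T.hom r * pointHom e R T g x := hw
  refine ⟨w, hw', fun i j => ?_⟩
  rw [conjEntry, conjRep_apply, Matrix.mul_apply]
  simp only [Matrix.mul_apply, Finset.sum_mul]
  rw [Finset.sum_comm, map_sum]
  refine Finset.sum_congr rfl fun s _ => ?_
  rw [map_sum]
  refine Finset.sum_congr rfl fun t _ => ?_
  rw [hw', map_mul]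
  exact mul_right_comm _ _ _

/-- If the matrix `Q a P` is upper triangular over `R ⊗ H`, then it defines a faithful triangular
representation of the base change of `G` to `R`. -/
theorem isTrigonalizable_of_conjEntry_eq_zero (e : specHopf k H ≅ G) [IsMonHom e.hom]
    (a : Matrix (Fin n) (Fin n) H)
    (ha : ∀ i j, Coalgebra.comul (R := k) (a i j) = ∑ l, a i l ⊗ₜ[k] a l j)
    (ha' : ∀ i j, Coalgebra.counit (R := k) (a i j) = (1 : Matrix (Fin n) (Fin n) k) i j)
    (P Q : Matrix (Fin n) (Fin n) R) (hPQ : P * Q = 1)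
    (hgen : Algebra.adjoin k (Set.range fun p : Fin n × Fin n => a p.1 p.2) = ⊤)
    (htri : ∀ i j, j < i → conjEntry (k := k) a P Q i j = 0) :
    IsTrigonalizable ((Over.pullback (baseMap k R)).obj G) := by
  refine isTrigonalizable_of_upperTriangular _ (conjRep e a ha ha' P Q hPQ)
    (fun h g => conjRep_comp e a ha ha' P Q hPQ h g)
    (fun T => conjRep_injective e a ha ha' P Q hPQ hgen T) fun T g i j hij => ?_
  obtain ⟨w, -, hw⟩ := exists_map_conjEntry e a ha ha' P Q hPQ T g
  rw [← hw, htri i j hij, map_zero]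

/-- An entry of `Q a P` over `R ⊗ H` vanishes if it vanishes on all points, the identity of
`Spec (R ⊗ H)` being the universal one. -/
lemma conjEntry_eq_zero (hPQ : P * Q = 1) (i j : Fin n)
    (h : ∀ T g, conjRep e a ha ha' P Q hPQ T g i j = 0) : conjEntry (k := k) a P Q i j = 0 := by
  -- the universal point, with values in `R ⊗ H`
  let T : Over (Spec (CommRingCat.of R)) := Over.mk (Y := Spec (CommRingCat.of (R ⊗[k] H)))
    (Spec.map (CommRingCat.ofHom Algebra.TensorProduct.includeLeftRingHom))
  let p : (Over.map (baseMap k R)).obj T ⟶ specHopf k H :=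
    Over.homMk (Spec.map (CommRingCat.ofHom
      (Algebra.TensorProduct.includeRight : H →ₐ[k] R ⊗[k] H).toRingHom)) (by
        change Spec.map _ ≫ Spec.map _ = Spec.map _ ≫ Spec.map _
        rw [← Spec.map_comp, ← Spec.map_comp, ← CommRingCat.ofHom_comp, ← CommRingCat.ofHom_comp]
        congr 2
        ext c
        exact ((Algebra.TensorProduct.includeRight (R := k) (A := R) (B := H)).commutes c).trans
          ((Algebra.TensorProduct.includeLeft (R := k) (S := k) (A := R) (B := H)).commutes c).symm)
  obtain ⟨w, hw, hw'⟩ := exists_map_conjEntry e a ha ha' P Q hPQ T ((hopfPoint e R T).symm p)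
  have hp : (pointHom e R T ((hopfPoint e R T).symm p) : H →+* Γ(T.left, ⊤)) =
      sharp (T := T.left) (A := .of H) p.left := by
    rw [pointHom, MulEquiv.apply_symm_apply]
  have hww : w = sharp (𝟙 (Spec (CommRingCat.of (R ⊗[k] H)))) := by
    apply Algebra.TensorProduct.ringHom_ext
    · ext r
      change w (r ⊗ₜ 1) = sharp (𝟙 _) (r ⊗ₜ 1)
      rw [hw, map_one, mul_one]
      exact sharp_specMap_apply (A := CommRingCat.of R) _ r
    · ext x
      change w (1 ⊗ₜ x) = sharp (𝟙 _) (1 ⊗ₜ x)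
      rw [hw, map_one, one_mul, hp]
      exact sharp_specMap_apply (A := CommRingCat.of H) _ x
  apply sharp_id_injective (CommRingCat.of (R ⊗[k] H))
  rw [← hww, hw', h, map_zero]

end ConjugateRep

/-! ### Commutative group schemes -/

section Commutative

open TensorProduct

variable {k : Type u} [Field k] {H : Type u} [CommRing H]

lemma tensor_eq_zero_of_forall_dual [Algebra k H] {M : Type*} [AddCommGroup M] [Module k M]
    (z : M ⊗[k] H) (h : ∀ ξ : H →ₗ[k] k, TensorProduct.rid k M (ξ.lTensor M z) = 0) : z = 0 := by
  classical
  let b := Module.Free.chooseBasis k H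
  apply (TensorProduct.equivFinsuppOfBasisRight b).injective
  ext i
  rw [TensorProduct.equivFinsuppOfBasisRight_apply, h, map_zero, Finsupp.zero_apply]

variable [HopfAlgebra k H]

/-- A functional `ξ` on `H` maps the entries of `Q a P` to those of `Q ξ(a) P`. -/
lemma rid_lTensor_conjEntry {R : Type u} [CommRing R] [Algebra k R] {n : ℕ}
    (a : Matrix (Fin n) (Fin n) H) (P Q : Matrix (Fin n) (Fin n) R) (i j : Fin n)
    (ξ : H →ₗ[k] k) :
    TensorProduct.rid k R (ξ.lTensor R (conjEntry a P Q i j)) =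
      (Q * a.map (fun x => algebraMap k R (ξ x)) * P) i j := by
  rw [conjEntry, map_sum, map_sum, Matrix.mul_apply]
  simp only [Matrix.mul_apply, Finset.sum_mul]
  rw [Finset.sum_comm]
  refine Finset.sum_congr rfl fun s _ => ?_
  rw [map_sum, map_sum]
  refine Finset.sum_congr rfl fun t _ => ?_
  rw [LinearMap.lTensor_tmul, TensorProduct.rid_tmul, Algebra.smul_def, Matrix.map_apply]
  ring

/-- The matrix coefficients of a representation of a commutative group scheme satisfy
`∑ a i l ⊗ a l j = ∑ a l j ⊗ a i l`: the two projections of `Spec (H ⊗ H)` are points of a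
commutative group. -/
lemma sum_tmul_eq_sum_tmul_of_isMulCommutative
    (hcomm : ∀ T, IsMulCommutative (T ⟶ specHopf k H))
    {n : ℕ} (a : Matrix (Fin n) (Fin n) H)
    (ha : ∀ i j, Coalgebra.comul (R := k) (a i j) = ∑ l, a i l ⊗ₜ[k] a l j)
    (i j : Fin n) :
    (∑ l, a i l ⊗ₜ[k] a l j) = ∑ l, a l j ⊗ₜ[k] a i l := by
  let T : Over (Spec (CommRingCat.of k)) := (Spec (CommRingCat.of (H ⊗[k] H))).asOver _
  let p : T ⟶ specHopf k H := Over.homMk (Spec.map (CommRingCat.ofHom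
    Algebra.TensorProduct.includeLeftRingHom)) (by
      change Spec.map _ ≫ Spec.map _ = Spec.map _
      rw [← Spec.map_comp, ← CommRingCat.ofHom_comp])
  let q : T ⟶ specHopf k H := Over.homMk (Spec.map (CommRingCat.ofHom
    (Algebra.TensorProduct.includeRight : H →ₐ[k] H ⊗[k] H).toRingHom)) (by
      change Spec.map _ ≫ Spec.map _ = Spec.map _
      rw [← Spec.map_comp, ← CommRingCat.ofHom_comp]
      congr 2
      ext c
      exact (Algebra.TensorProduct.includeRight (R := k) (A := H) (B := H)).commutes c)
  let w : H ⊗[k] H →+* Γ(T.left, ⊤) := sharp (A := CommRingCat.of (H ⊗[k] H)) (𝟙 T.left)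
  have hp (x : H) : sharp p.left x = w (x ⊗ₜ[k] (1 : H)) :=
    sharp_specMap_apply (A := CommRingCat.of H) _ x
  have hq (x : H) : sharp q.left x = w ((1 : H) ⊗ₜ[k] x) :=
    sharp_specMap_apply (A := CommRingCat.of H) _ x
  apply sharp_id_injective (CommRingCat.of (H ⊗[k] H))
  have h := congr(sharp ($((hcomm T).is_comm.comm p q)).left (a i j))
  rw [sharp_mul p q _ _ _ (ha i j), sharp_mul q p _ _ _ (ha i j)] at h
  simp only [hp, hq, ← map_mul, ← map_sum, Algebra.TensorProduct.tmul_mul_tmul, one_mul,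
    mul_one] at h
  exact h

/-- Over an algebraically closed extension, the representations of a commutative group scheme are
triangularizable: the scalar matrices `ξ(a)`, for the linear functionals `ξ` on `H`, commute. -/
theorem exists_conjEntry_eq_zero_of_isMulCommutative
    (hcomm : ∀ T, IsMulCommutative (T ⟶ specHopf k H))
    {n : ℕ} (a : Matrix (Fin n) (Fin n) H)
    (ha : ∀ i j, Coalgebra.comul (R := k) (a i j) = ∑ l, a i l ⊗ₜ[k] a l j)
    (K : Type u) [Field K] [IsAlgClosed K] [Algebra k K] :
    ∃ P Q : Matrix (Fin n) (Fin n) K, P * Q = 1 ∧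
      ∀ i j, j < i → conjEntry (k := k) a P Q i j = 0 := by
  obtain ⟨P, Q, hPQ, h⟩ := exists_conj_upperTriangular_of_commute
    (fun ξ : H →ₗ[k] k => a.map (fun x => algebraMap k K (ξ x))) (fun ξ η' => by
      ext i j
      have := congr(algebraMap k K (TensorProduct.lid k k (TensorProduct.map ξ η'
        $(sum_tmul_eq_sum_tmul_of_isMulCommutative hcomm a ha i j))))
      simp only [map_sum, TensorProduct.map_tmul, TensorProduct.lid_tmul, smul_eq_mul,
        map_mul] at this
      simpa only [Matrix.mul_apply, Matrix.map_apply, mul_comm] using this)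
  refine ⟨P, Q, hPQ, fun i j hij => tensor_eq_zero_of_forall_dual _ fun ξ => ?_⟩
  rw [rid_lTensor_conjEntry, h ξ i j hij]

end Commutative

/-! ### Two facts on connectedness -/

section Topology

/-- A space is connected if it has an open and closed map onto a connected space with a fibre
consisting of one point. -/
lemma connectedSpace_of_isOpenMap_of_isClosedMap {X Y : Type*} [TopologicalSpace X]
    [TopologicalSpace Y] [ConnectedSpace Y] {f : X → Y} (ho : IsOpenMap f) (hc : IsClosedMap f)
    (x : X) (hx : ∀ x', f x' = f x → x' = x) : ConnectedSpace X := by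
  have key : ∀ U : Set X, IsClopen U → U.Nonempty → x ∈ U := by
    intro U hU hne
    have : f '' U = Set.univ :=
      IsClopen.eq_univ ⟨hc _ hU.1, ho _ hU.2⟩ (hne.image f)
    obtain ⟨x', hx', h⟩ := this.symm ▸ Set.mem_univ (f x)
    exact hx x' h ▸ hx'
  have : PreconnectedSpace X := preconnectedSpace_iff_clopen.2 fun U hU => by
    by_contra! h
    obtain ⟨h1, h2⟩ := h
    have hUc : Uᶜ.Nonempty := Set.nonempty_compl.2 h2
    exact key Uᶜ hU.compl hUc (key U hU h1)
  exact ⟨⟨x⟩⟩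

lemma isPreconnected_closedPoints (X : Type*) [TopologicalSpace X] [JacobsonSpace X]
    [PreconnectedSpace X] : IsPreconnected (closedPoints X) := by
  rw [isPreconnected_closed_iff]
  intro t t' ht ht' hsub h h'
  have huniv : t ∪ t' = Set.univ := by
    rw [← Set.univ_subset_iff, ← closure_closedPoints]
    exact closure_minimal hsub (ht.union ht')
  obtain ⟨z, -, hz⟩ := isPreconnected_closed_iff.1 isPreconnected_univ t t' ht ht' huniv.ge
    (h.mono fun _ h => ⟨trivial, h.2⟩) (h'.mono fun _ h => ⟨trivial, h.2⟩)
  rw [Set.inter_comm]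
  exact nonempty_inter_closedPoints ⟨z, hz⟩ (ht.inter ht').isLocallyClosed

end Topology

/-! ### The Zariski topology on rational points -/

section Points

variable {K : Type u} [Field K]

/-- The rational points of a scheme over `K`. -/
abbrev RatPoint (X : Over (Spec (CommRingCat.of K))) : Type u :=
  𝟙_ (Over (Spec (CommRingCat.of K))) ⟶ X

/-- The point of the underlying space of `X` given by a rational point. -/
def RatPoint.toPoint {X : Over (Spec (CommRingCat.of K))} (g : RatPoint X) : X.left :=
  (show Spec (CommRingCat.of K) ⟶ X.left from g.left) (IsLocalRing.closedPoint K)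

/-- The Zariski topology on the rational points: the one induced from the underlying space by
`RatPoint.toPoint`. -/
instance (X : Over (Spec (CommRingCat.of K))) : TopologicalSpace (RatPoint X) :=
  .induced RatPoint.toPoint inferInstance

lemma RatPoint.isInducing_toPoint (X : Over (Spec (CommRingCat.of K))) :
    Topology.IsInducing (RatPoint.toPoint (X := X)) := ⟨rfl⟩

lemma RatPoint.continuous_comp {X Y : Over (Spec (CommRingCat.of K))} (c : X ⟶ Y) :
    Continuous fun g : RatPoint X => (g ≫ c : RatPoint Y) := by
  rw [(RatPoint.isInducing_toPoint Y).continuous_iff]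
  exact c.left.continuous.comp (RatPoint.isInducing_toPoint X).continuous

/-- Translations and the maps `g ↦ g a g⁻¹` are continuous, being induced by morphisms of
schemes. -/
instance (X : Over (Spec (CommRingCat.of K))) [GrpObj X] : IsSemitopologicalGroup (RatPoint X) where
  continuous_mul_left a := by
    convert RatPoint.continuous_comp ((toUnit X ≫ a) * 𝟙 X) using 2 with g
    rw [MonObj.comp_mul, Category.comp_id, comp_toUnit_assoc, toUnit_unit, Category.id_comp]
  continuous_mul_right a := by
    convert RatPoint.continuous_comp (𝟙 X * (toUnit X ≫ a)) using 2 with g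
    rw [MonObj.comp_mul, Category.comp_id, comp_toUnit_assoc, toUnit_unit, Category.id_comp]
  continuous_conj a := by
    convert RatPoint.continuous_comp (𝟙 X * (toUnit X ≫ a) * (𝟙 X)⁻¹) using 2 with g
    rw [MonObj.comp_mul, MonObj.comp_mul, GrpObj.comp_inv, Category.comp_id, comp_toUnit_assoc,
      toUnit_unit, Category.id_comp]

lemma mem_basicOpen_specField_iff (f : Γ(Spec (CommRingCat.of K), ⊤))
    (x : Spec (CommRingCat.of K)) : x ∈ (Spec (CommRingCat.of K)).basicOpen f ↔ f ≠ 0 := by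
  constructor
  · rintro hx rfl
    rw [Scheme.basicOpen_zero] at hx
    exact hx
  · intro hf
    obtain ⟨c, rfl⟩ :=
      (Scheme.ΓSpecIso (CommRingCat.of K)).symm.commRingCatIsoToRingEquiv.surjective f
    have hc : IsUnit (show K from c) := by
      refine IsUnit.mk0 _ fun h => hf ?_
      rw [show c = 0 from h, map_zero]
    rw [Scheme.basicOpen_of_isUnit _ (hc.map _)]
    trivial

lemma RatPoint.toPoint_mem_basicOpen_iff {X : Over (Spec (CommRingCat.of K))} (g : RatPoint X)
    (f : Γ(X.left, ⊤)) : g.toPoint ∈ X.left.basicOpen f ↔ g.left.appTop f ≠ 0 := by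
  let g' : Spec (CommRingCat.of K) ⟶ X.left := g.left
  refine Iff.trans ?_ (mem_basicOpen_specField_iff (g'.appTop f) (IsLocalRing.closedPoint K))
  rw [← Scheme.preimage_basicOpen_top]
  rfl

lemma RatPoint.isClosed_setOf_appTop_eq_zero {X : Over (Spec (CommRingCat.of K))}
    (f : Γ(X.left, ⊤)) : IsClosed {g : RatPoint X | g.left.appTop f = 0} := by
  refine ⟨?_⟩
  convert (X.left.basicOpen f).isOpen.preimage (RatPoint.isInducing_toPoint X).continuous using 1
  ext g
  exact (RatPoint.toPoint_mem_basicOpen_iff g f).symm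

variable [IsAlgClosed K] (X : Over (Spec (CommRingCat.of K))) [LocallyOfFiniteType X.hom]

lemma RatPoint.range_toPoint : Set.range (RatPoint.toPoint (X := X)) = closedPoints X.left := by
  ext x
  constructor
  · rintro ⟨g, rfl⟩
    exact (pointEquivClosedPoint X.hom ⟨g.left, Over.w g⟩).2
  · intro hx
    obtain ⟨⟨p, hp⟩, h⟩ := (pointEquivClosedPoint X.hom).surjective ⟨x, hx⟩
    exact ⟨Over.homMk p hp, congr($h.1)⟩

lemma RatPoint.connectedSpace [Nonempty (RatPoint X)] [ConnectedSpace X.left] :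
    ConnectedSpace (RatPoint X) := by
  have : JacobsonSpace X.left := LocallyOfFiniteType.jacobsonSpace X.hom
  have : PreconnectedSpace (RatPoint X) := ⟨by
    rw [← (RatPoint.isInducing_toPoint X).isPreconnected_image, Set.image_univ,
      RatPoint.range_toPoint]
    exact isPreconnected_closedPoints _⟩
  exact ⟨inferInstance⟩

/-- A global function on a reduced scheme of finite type over an algebraically closed field is
determined by its values at the rational points. -/
lemma eq_zero_of_forall_ratPoint [IsReduced X.left] (f : Γ(X.left, ⊤))
    (h : ∀ g : RatPoint X, g.left.appTop f = 0) : f = 0 := by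
  have : JacobsonSpace X.left := LocallyOfFiniteType.jacobsonSpace X.hom
  apply eq_zero_of_basicOpen_eq_bot
  by_contra hne
  obtain ⟨x, hx⟩ := (TopologicalSpace.Opens.ne_bot_iff_nonempty _).1 hne
  obtain ⟨y, hy, hy'⟩ := nonempty_inter_closedPoints ⟨x, hx⟩
    (X.left.basicOpen f).isOpen.isLocallyClosed
  rw [← RatPoint.range_toPoint] at hy'
  obtain ⟨g, rfl⟩ := hy'
  exact (RatPoint.toPoint_mem_basicOpen_iff g f).1 hy (h g)

end Points

/-! ### Connectedness after base change -/

section ConnectedBaseChange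

variable {k K : Type u} [Field k] [Field K] [Algebra k K]

/-- The fibre of `X_K ⟶ X` over a rational point is `Spec K`; for `K` algebraic over `k` the map is
open and closed. -/
lemma connectedSpace_pullback [Algebra.IsAlgebraic k K]
    (X : Over (Spec (CommRingCat.of k))) [ConnectedSpace X.left] (g : RatPoint X) :
    ConnectedSpace ((Over.pullback (baseMap k K)).obj X).left := by
  change ConnectedSpace (pullback X.hom (baseMap k K) :)
  let p := pullback.fst X.hom (baseMap k K)
  let g' : Spec (CommRingCat.of k) ⟶ X.left := g.left
  have hg : g' ≫ X.hom = 𝟙 _ := Over.w g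
  have : IsIntegralHom (baseMap k K) := by
    rw [IsIntegralHom.SpecMap_iff]
    exact algebraMap_isIntegral_iff.2 inferInstance
  have hsub : Subsingleton (pullback p g' :) := by
    have h1 : IsPullback (pullback.snd p g') (pullback.fst p g' ≫ pullback.snd X.hom (baseMap k K))
        (g' ≫ X.hom) (baseMap k K) :=
      (IsPullback.of_hasPullback p g').flip.paste_vert (IsPullback.of_hasPullback X.hom _)
    rw [hg] at h1
    have : IsIso (pullback.fst p g' ≫ pullback.snd X.hom (baseMap k K)) := h1.isIso_snd_of_isIso
    exact (pullback.fst p g' ≫ pullback.snd X.hom (baseMap k K)).homeomorph.subsingleton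
  have hrange := Scheme.Pullback.range_fst (f := p) (g := g')
  have hp : Surjective p := inferInstance
  obtain ⟨x, hx⟩ := hp.surj (g' (IsLocalRing.closedPoint k))
  refine connectedSpace_of_isOpenMap_of_isClosedMap (f := p) p.isOpenMap p.isClosedMap x
    fun x' h => ?_
  have hmem : ∀ y, p y = g' (IsLocalRing.closedPoint k) → y ∈ Set.range (pullback.fst p g') :=
    fun y hy => hrange ▸ ⟨_, hy.symm⟩
  obtain ⟨y, rfl⟩ := hmem x hx
  obtain ⟨y', rfl⟩ := hmem x' (h.trans hx)
  rw [Subsingleton.elim y y']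

end ConnectedBaseChange

/-! ### Smooth algebras over a field are reduced -/

section Reduced

open TensorProduct

/-- A smooth algebra `S` over a field `K` is reduced. If `a` is nilpotent, then `a ⊗ X` is integral
over `S` in `S ⊗ K[X]`. As integral closure commutes with smooth base change and `K` is integrally
closed in `K[X]`, it has no linear term, so `a = 0`. -/
lemma isReduced_of_smooth_field (K S : Type u) [Field K] [CommRing S] [Algebra K S]
    [Algebra.Smooth K S] : IsReduced S := by
  refine ⟨fun a ha => ?_⟩
  let z : S ⊗[K] Polynomial K := a ⊗ₜ Polynomial.X
  have hz : IsNilpotent z := by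
    obtain ⟨m, hm⟩ := ha
    exact ⟨m, by simp [z, Algebra.TensorProduct.tmul_pow, hm]⟩
  have hint : IsIntegral S z := by
    obtain ⟨m, hm⟩ := hz
    exact ⟨Polynomial.X ^ m, Polynomial.monic_X_pow m, by simp [hm]⟩
  obtain ⟨y, hy⟩ := (TensorProduct.toIntegralClosure_bijective_of_smooth (R := K) (S := S)
    (B := Polynomial K)).2 ⟨z, hint⟩
  -- elements of `K[X]` integral over `K` are constant, so their coefficient of `X` vanishes
  have hconst (f : integralClosure K (Polynomial K)) : f.1.coeff 1 = 0 := by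
    obtain ⟨p, hp, hpf⟩ := f.2
    rw [← Polynomial.aeval_def] at hpf
    rcases Polynomial.comp_eq_zero_iff.1 ((Polynomial.comp_eq_aeval ..).trans hpf) with h | ⟨-, h⟩
    · exact absurd h hp.ne_zero
    · rw [h, Polynomial.coeff_C_succ]
  let φ : S ⊗[K] Polynomial K →ₗ[K] S :=
    (TensorProduct.rid K S).toLinearMap ∘ₗ (Polynomial.lcoeff K 1).lTensor S
  have hφ (y : S ⊗[K] integralClosure K (Polynomial K)) :
      φ (TensorProduct.toIntegralClosure K S (Polynomial K) y).1 = 0 := by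
    induction y with
    | zero => simp
    | add x y hx hy => rw [map_add, Subalgebra.coe_add, map_add, hx, hy, add_zero]
    | tmul x y => simp [φ, TensorProduct.toIntegralClosure, hconst y]
  have := hφ y
  rw [hy] at this
  simpa [φ, z] using this

lemma isReduced_of_smooth {K : Type u} [Field K] (X : Scheme.{u}) (f : X ⟶ Spec (CommRingCat.of K))
    [Smooth f] [IsAffine X] : IsReduced X := by
  have h : (sharp f).Smooth :=
    (RingHom.Smooth.of_bijective
      (Scheme.ΓSpecIso (.of K)).symm.commRingCatIsoToRingEquiv.bijective).comp
      (HasRingHomProperty.appTop (P := @Smooth) f inferInstance)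
  algebraize [sharp f]
  have : _root_.IsReduced Γ(X, ⊤) := isReduced_of_smooth_field K Γ(X, ⊤)
  have := (affine_isReduced_iff Γ(X, ⊤)).2 this
  exact isReduced_of_isOpenImmersion X.isoSpec.hom

end Reduced

/-! ### Solvable group schemes -/

section Solvable

/-- The commutators of `G(T)` lie in the image of `N(T)` at each step of the chain. -/
lemma IsSolvableGroupScheme.isSolvable {S : Scheme.{u}} {G : Over S} [GrpObj G]
    (h : IsSolvableGroupScheme G) (T : Over S) : Group.IsSolvable (T ⟶ G) := by
  induction h with
  | trivial G h =>
    obtain ⟨e⟩ := h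
    have : Subsingleton (T ⟶ G) := ⟨fun f g => by
      rw [← cancel_mono e.hom]
      exact toUnit_unique _ _⟩
    infer_instance
  | step G N φ closed normal comm solvable ih =>
    obtain ⟨c, hc⟩ := comm
    refine Group.isSolvable_of_ker_le_range (IsMonHom.monoidHom φ T) (Abelianization.of) ?_
    rw [Abelianization.ker_of, commutator_def, Subgroup.commutator_le]
    rintro g - h -
    refine ⟨lift g h ≫ c, ?_⟩
    change (lift g h ≫ c) ≫ φ = _
    rw [Category.assoc, hc, GrpObj.lift_commutator_eq_mul_mul_inv_inv, commutatorElement_def]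

variable {k : Type u} [Field k] {H : Type u} [CommRing H] [HopfAlgebra k H]

open TensorProduct

/-- Over an algebraic closure, the representations of a smooth connected solvable group scheme are
triangularizable: those of its group of rational points are, by the theorem of Lie and Kolchin, and
the rational points detect the vanishing of functions on the reduced scheme `G_K`. -/
theorem exists_conjEntry_eq_zero_of_isSolvableGroupScheme
    {G : Over (Spec (CommRingCat.of k))} [GrpObj G] [IsAffineHom G.hom] [Smooth G.hom]
    [ConnectedSpace G.left] (hG : IsSolvableGroupScheme G)
    (e : specHopf k H ≅ G) [IsMonHom e.hom] {n : ℕ} (a : Matrix (Fin n) (Fin n) H)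
    (ha : ∀ i j, Coalgebra.comul (R := k) (a i j) = ∑ l, a i l ⊗ₜ[k] a l j)
    (ha' : ∀ i j, Coalgebra.counit (R := k) (a i j) = (1 : Matrix (Fin n) (Fin n) k) i j)
    (K : Type u) [Field K] [IsAlgClosed K] [Algebra k K] [Algebra.IsAlgebraic k K] :
    ∃ P Q : Matrix (Fin n) (Fin n) K, P * Q = 1 ∧
      ∀ i j, j < i → conjEntry (k := k) a P Q i j = 0 := by
  let X := (Over.pullback (baseMap k K)).obj G
  have : Smooth X.hom := inferInstanceAs (Smooth (pullback.snd G.hom (baseMap k K)))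
  have : IsAffineHom X.hom := inferInstanceAs (IsAffineHom (pullback.snd G.hom (baseMap k K)))
  have : IsAffine X.left := isAffine_of_isAffineHom X.hom
  have : IsReduced X.left := isReduced_of_smooth X.left X.hom
  have : ConnectedSpace X.left := connectedSpace_pullback G 1
  have : Nonempty (RatPoint X) := ⟨1⟩
  have : ConnectedSpace (RatPoint X) := RatPoint.connectedSpace X
  have : Group.IsSolvable (RatPoint X) :=
    have := hG.isSolvable ((Over.map (baseMap k K)).obj (𝟙_ _))
    Group.isSolvable_of_isSolvable_injective
      (f := (pointsPullback (baseMap k K) G (𝟙_ _)).toMonoidHom)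
      (MulEquiv.injective _)
  let ε : Γ((𝟙_ (Over (Spec (CommRingCat.of K)))).left, ⊤) ≃+* K :=
    (Scheme.ΓSpecIso (CommRingCat.of K)).commRingCatIsoToRingEquiv
  have hε (c : K) : ε (sharp (𝟙_ (Over (Spec (CommRingCat.of K)))).hom c) = c := by
    change (Scheme.ΓSpecIso (CommRingCat.of K)).hom (sharp (𝟙 (Spec (CommRingCat.of K))) c) = c
    rw [sharp_id]
    exact congr($((Scheme.ΓSpecIso (CommRingCat.of K)).inv_hom_id) c)
  have hsharp (g : RatPoint X) (c : K) : ε (g.left.appTop (sharp X.hom c)) = c := by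
    refine Eq.trans ?_ (hε c)
    rw [← Over.w g, sharp_comp]
    rfl
  -- the representation on the rational points; its matrix coefficients are the values of functions
  let A : RatPoint X →* Matrix (Fin n) (Fin n) K :=
    (ε.toRingHom.mapMatrix (m := Fin n)).toMonoidHom.comp (baseRep e a ha ha' K (𝟙_ _))
  have hA (g : RatPoint X) (i j : Fin n) :
      A g i j = ε (g.left.appTop (baseRep e a ha ha' K X (𝟙 X) i j)) := by
    have := congr(ε ($(baseRep_comp e a ha ha' K g (𝟙 X)) i j))
    rw [Category.comp_id] at this
    exact this
  obtain ⟨P, Q, hPQ, h⟩ := exists_conj_upperTriangular_of_isSolvable A fun C c => by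
    convert RatPoint.isClosed_setOf_appTop_eq_zero
      ((∑ i, ∑ j, sharp X.hom (C i j) * baseRep e a ha ha' K X (𝟙 X) i j) - sharp X.hom c) using 1
    ext g
    rw [Set.mem_ofPred_eq, Set.mem_ofPred_eq, ← map_eq_zero_iff ε ε.injective, map_sub, map_sub,
      hsharp, sub_eq_zero]
    simp only [map_sum, map_mul, hsharp, hA]
  refine ⟨P, Q, hPQ, fun i j hij => conjEntry_eq_zero e a ha ha' P Q hPQ i j fun T g => ?_⟩
  -- it suffices to consider the identity of `X`, the universal point, on the rational points
  have huniv : conjRep e a ha ha' P Q hPQ X (𝟙 X) i j = 0 := by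
    refine eq_zero_of_forall_ratPoint X _ fun g => ?_
    rw [← map_eq_zero_iff ε ε.injective]
    have hconj := congr(ε ($(conjRep_comp e a ha ha' P Q hPQ g (𝟙 X)) i j))
    rw [Category.comp_id] at hconj
    refine hconj.symm.trans (Eq.trans ?_ (h g i j hij))
    have hmat (M : Matrix (Fin n) (Fin n) K) :
        ε.toRingHom.mapMatrix (M.map (sharp (𝟙_ (Over (Spec (CommRingCat.of K)))).hom)) = M :=
      Matrix.ext fun i j => hε (M i j)
    change ε.toRingHom.mapMatrix (Q.map _ * baseRep e a ha ha' K _ g * P.map _) i j = _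
    rw [map_mul, map_mul, hmat, hmat]
    rfl
  have := congr($(conjRep_comp e a ha ha' P Q hPQ g (𝟙 X)) i j)
  rw [Category.comp_id] at this
  rw [this, Matrix.map_apply, huniv, map_zero]

end Solvable

/-! ### Descent to a finite extension -/

section Descent

open TensorProduct

variable {k : Type u} [Field k] {H : Type u} [CommRing H] [HopfAlgebra k H] {n : ℕ}

lemma map_conjEntry {L K : Type u} [CommRing L] [CommRing K] [Algebra k L] [Algebra k K]
    (f : L →ₐ[k] K) (a : Matrix (Fin n) (Fin n) H) (P Q : Matrix (Fin n) (Fin n) L) (i j : Fin n) :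
    f.toLinearMap.rTensor H (conjEntry a P Q i j) = conjEntry a (P.map f) (Q.map f) i j := by
  simp [conjEntry]

/-- Conjugating matrices over an algebraic extension have their entries in a finite one. -/
lemma exists_finite_conjEntry_eq_zero {K : Type u} [Field K] [Algebra k K] [Algebra.IsAlgebraic k K]
    (a : Matrix (Fin n) (Fin n) H) (P Q : Matrix (Fin n) (Fin n) K) (hPQ : P * Q = 1)
    (h : ∀ i j, j < i → conjEntry (k := k) a P Q i j = 0) :
    ∃ (L : Type u) (_ : Field L) (_ : Algebra k L) (_ : Module.Finite k L)
      (P' Q' : Matrix (Fin n) (Fin n) L), P' * Q' = 1 ∧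
        ∀ i j, j < i → conjEntry (k := k) a P' Q' i j = 0 := by
  let s : Set K := (Set.range fun p : Fin n × Fin n => P p.1 p.2) ∪
    Set.range fun p : Fin n × Fin n => Q p.1 p.2
  let L := IntermediateField.adjoin k s
  have hs : s.Finite := (Set.finite_range _).union (Set.finite_range _)
  have : Finite s := hs
  have hfin : Module.Finite k L :=
    IntermediateField.finiteDimensional_adjoin fun x _ => Algebra.IsIntegral.isIntegral x
  let P' : Matrix (Fin n) (Fin n) L := fun i j =>
    ⟨P i j, IntermediateField.subset_adjoin k s (Or.inl ⟨(i, j), rfl⟩)⟩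
  let Q' : Matrix (Fin n) (Fin n) L := fun i j =>
    ⟨Q i j, IntermediateField.subset_adjoin k s (Or.inr ⟨(i, j), rfl⟩)⟩
  refine ⟨L, inferInstance, inferInstance, hfin, P', Q', ?_, fun i j hij => ?_⟩
  · apply Matrix.map_injective L.val.toRingHom.injective
    beta_reduce
    rw [Matrix.map_mul, Matrix.map_one _ (map_zero _) (map_one _)]
    exact hPQ
  · apply Module.Flat.rTensor_preserves_injective_linearMap (M := H) L.val.toLinearMap
      L.val.injective
    rw [map_conjEntry, map_zero]
    exact h i j hij

end Descent

/-! ### Trigonalization of affine group schemes -/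

lemma finiteType_of_locallyOfFiniteType {k : Type u} [Field k] {H : Type u} [CommRing H]
    [HopfAlgebra k H] {G : Over (Spec (CommRingCat.of k))} [LocallyOfFiniteType G.hom]
    (e : specHopf k H ≅ G) : Algebra.FiniteType k H := by
  have h : LocallyOfFiniteType (Spec.map (CommRingCat.ofHom (algebraMap k H))) := by
    have : LocallyOfFiniteType (e.hom.left ≫ G.hom) := by
      have : IsIso e.hom.left := inferInstanceAs (IsIso ((Over.forget _).map e.hom))
      infer_instance
    rw [Over.w] at this
    exact this
  rw [HasRingHomProperty.Spec_iff (P := @LocallyOfFiniteType)] at h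
  exact RingHom.finiteType_algebraMap.1 h

end TrigGroupScheme

end

theorem mainTheorem7 {k : Type u} [Field k] (kbar : Type u) [Field kbar] [Algebra k kbar]
    [IsAlgClosure k kbar] (G : Over (Spec (CommRingCat.of k))) [GrpObj G]
    [IsAffineHom G.hom] [LocallyOfFiniteType G.hom]
    (hG : IsCommMonObj G ∨
      (Smooth G.hom ∧ TrigGroupScheme.IsSolvableGroupScheme G ∧ ConnectedSpace G.left)) :
    TrigGroupScheme.IsTrigonalizable
        ((Over.pullback (Spec.map (CommRingCat.ofHom (algebraMap k kbar)))).obj G) ∧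
      TrigGroupScheme.IsLocallyTrigonalizable G := by
  have : IsAlgClosed kbar := IsAlgClosure.isAlgClosed k
  have : Algebra.IsAlgebraic k kbar := IsAlgClosure.isAlgebraic
  obtain ⟨H, _, _, e, _⟩ := TrigGroupScheme.exists_hopfAlgebra G
  have := TrigGroupScheme.finiteType_of_locallyOfFiniteType e
  obtain ⟨n, a, ha, ha', hgen⟩ :=
    TrigGroupScheme.exists_generating_multiplicative_matrix (k := k) (H := H)
  obtain ⟨P, Q, hPQ, h⟩ : ∃ P Q : Matrix (Fin n) (Fin n) kbar, P * Q = 1 ∧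
      ∀ i j, j < i → TrigGroupScheme.conjEntry (k := k) a P Q i j = 0 := by
    obtain hG | ⟨_, hG, _⟩ := hG
    · refine TrigGroupScheme.exists_conjEntry_eq_zero_of_isMulCommutative
        (fun T => ⟨⟨fun x y => ?_⟩⟩) a ha kbar
      have := (isCommMonObj_iff_isMulCommutative G).1 hG T
      apply (Hom.mulEquivCongrRight e T).injective
      rw [map_mul, map_mul]
      exact this.is_comm.comm _ _
    · exact TrigGroupScheme.exists_conjEntry_eq_zero_of_isSolvableGroupScheme hG e a ha ha' kbar
  refine ⟨TrigGroupScheme.isTrigonalizable_of_conjEntry_eq_zero e a ha ha' P Q hPQ hgen h, ?_⟩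
  obtain ⟨L, _, _, _, P', Q', hPQ', h'⟩ :=
    TrigGroupScheme.exists_finite_conjEntry_eq_zero a P Q hPQ h
  refine ⟨Spec (.of L), TrigGroupScheme.baseMap k L, ?_, ?_, ?_, ?_,
    TrigGroupScheme.isTrigonalizable_of_conjEntry_eq_zero e a ha ha' P' Q' hPQ' hgen h'⟩
  · rw [IsFinite.SpecMap_iff]
    exact RingHom.finite_algebraMap.2 inferInstance
  · infer_instance
  · rw [HasRingHomProperty.Spec_iff (P := @LocallyOfFinitePresentation)]
    exact RingHom.finitePresentation_algebraMap.2
      (Algebra.FinitePresentation.of_finiteType.1 inferInstance)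
  · infer_instance
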